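/- Let $\mathbb K$ be an algebraically closed field of characteristic zero, and let $X$ be a normal affine (irreducible) variety over $\mathbb K$ with an effective regular action of an algebraic torus $T=(\mathbb K^\times)^r$ having an open orbit (so $X$ is an affine toric variety). Assume that every invertible function in $\mathbb K[X]$ is constant. Let $M=\mathfrak X(T)=\mathbb Z^r$, let $N=\mathrm{Hom}(M,\mathbb Z)$, let $\sigma\subset N_{\mathbb Q}$ be the cone of $X$, i.e. the dual of the cone in $M_{\mathbb Q}$ generated by the weights of $T$ on $\mathbb K[X]$, and let $\Delta(1)$ be the (finite) set of one-dimensional faces of $\sigma$. For $\rho\in\Delta(1)$ let $D_\rho\subset X$ be the closed $T$-stable subset whose ideal is generated by the $T$-semi-invariant functions whose weight is positive on $\rho\setminus\{0\}$; the $D_\rho$ are exactly the $T$-invariant prime divisors of $X$, each occurring for exactly one $\rho$. Let $\mathrm{Cox}(X)=\mathbb K[x_\rho:\rho\in\Delta(1)]$, graded by $\mathrm{Cl}(X)$ via $\deg x_\rho=[D_\rho]$. The divisor class group $\mathrm{Cl}(X)$ is finitely generated. Choose any decomposition $\mathrm{Cl}(X)\cong\mathbb Z^n\oplus\mathbb Z/k_1\oplus\dots\oplus\mathbb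 Z/k_s$ $(k_j\ge 1)$, with standard generators $\xi_1,\dots,\xi_n,\eta_1,\dots,\eta_s$, any divisors $E_i$, $W_j$ with $[E_i]=\xi_i$, $[W_j]=\eta_j$, and any nonzero rational functions $F_j$ with $(F_j)=k_jW_j$. With $H^0(X,D)=\{f\in\mathbb K(X): f=0\text{ or }(f)+D\ge 0\}$, let $$S(X)=\bigoplus_{\lambda_i\in\mathbb Z,\;0\le\mu_j<k_j}H^0\Bigl(X,\sum_i\lambda_iE_i+\sum_j\mu_jW_j\Bigr),$$ with the component of index $(\lambda,\mu)$ having degree $\sum\lambda_i\xi_i+\sum\mu_j\eta_j\in\mathrm{Cl}(X)$, and with the bilinear multiplication given for $f$ of index $(a,b)$ and $g$ of index $(c,d)$ by $$f*g=fg\prod_jF_j^{\lfloor (b_j+d_j)/k_j\rfloor}.$$ This is a commutative $\mathrm{Cl}(X)$-graded $\mathbb K$-algebra. Then $S(X)$ and $\mathrm{Cox}(X)$ are isomorphic as $\mathrm{Cl}(X)$-graded $\mathbb K$-algebras: there is a $\mathbb K$-algebra isomorphism mapping, for every $\alpha\in\mathrm{Cl}(X)$, the component of degree $\alpha$ of $S(X)$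 onto the component of degree $\alpha$ of $\mathrm{Cox}(X)$. In particular, $S(X)$ is a polynomial ring. -/

import Mathlib

set_option linter.unusedSectionVars false

noncomputable section

/-! ### Weil divisors on a normal affine variety

A normal affine variety `X` is given by its coordinate ring `A`.  Prime divisors are the primes of
height one, the field of rational functions is `FractionRing A`. -/

/-- A prime divisor on `Spec A`: a prime ideal of height one. -/
@[ext]
structure PrimeDivisor (A : Type*) [CommRing A] extends PrimeSpectrum A where
  height_eq : asIdeal.height = 1

namespace PrimeDivisor

variable {A : Type*} [CommRing A]

instance (P : PrimeDivisor A) : P.asIdeal.IsPrime := P.isPrime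

/-- The local ring of `Spec A` along the prime divisor `P`. -/
abbrev LocalRing (P : PrimeDivisor A) : Type _ := Localization.AtPrime P.asIdeal

variable [IsDomain A]

/-- The field of rational functions is an algebra over the local ring along `P`. -/
instance (P : PrimeDivisor A) : Algebra P.LocalRing (FractionRing A) :=
  (IsLocalization.lift (M := P.asIdeal.primeCompl) (S := P.LocalRing)
    (g := algebraMap A (FractionRing A)) fun y =>
      IsLocalization.map_units (M := nonZeroDivisors A) (FractionRing A)
        ⟨y.1, P.asIdeal.primeCompl_le_nonZeroDivisors y.2⟩).toAlgebra

instance (P : PrimeDivisor A) : IsScalarTower A P.LocalRing (FractionRing A) :=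
  IsScalarTower.of_algebraMap_eq fun x => (IsLocalization.lift_eq _ x).symm

instance (P : PrimeDivisor A) : IsFractionRing P.LocalRing (FractionRing A) :=
  IsFractionRing.isFractionRing_of_isDomain_of_isLocalization P.asIdeal.primeCompl P.LocalRing
    (FractionRing A)

variable [IsNoetherianRing A] [IsIntegrallyClosed A]

instance (P : PrimeDivisor A) : IsDiscreteValuationRing P.LocalRing := by
  have hdim : ringKrullDim P.LocalRing = 1 := by
    rw [IsLocalization.AtPrime.ringKrullDim_eq_height P.asIdeal P.LocalRing, P.height_eq]
    rfl
  have hnf : ¬ IsField P.LocalRing := by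
    intro h
    rw [ringKrullDim_eq_zero_of_isField h] at hdim
    exact zero_ne_one hdim
  have h1 : Ring.KrullDimLE 1 P.LocalRing := by
    rw [Ring.KrullDimLE, Order.krullDimLE_iff]
    exact hdim.le
  have h2 : IsIntegrallyClosed P.LocalRing :=
    isIntegrallyClosed_of_isLocalization _ P.asIdeal.primeCompl
      P.asIdeal.primeCompl_le_nonZeroDivisors
  have h3 : Ring.DimensionLEOne P.LocalRing :=
    ⟨fun {I} hI hp => Ring.krullDimLE_one_iff_of_noZeroDivisors.mp h1 I hI hp⟩
  have h4 : IsDedekindDomain P.LocalRing := { }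
  exact ((IsDiscreteValuationRing.TFAE P.LocalRing hnf).out 0 2).mpr h4

/-- The order of vanishing of the rational function `f` along `P` (with value `0` at `f = 0`). -/
def ord (P : PrimeDivisor A) (f : FractionRing A) : ℤ :=
  WithZero.log (Ring.ordFrac P.LocalRing f)

theorem ord_one (P : PrimeDivisor A) : P.ord 1 = 0 := by simp [ord]

theorem ord_mul (P : PrimeDivisor A) {f g : FractionRing A} (hf : f ≠ 0) (hg : g ≠ 0) :
    P.ord (f * g) = P.ord f + P.ord g := by
  rw [ord, map_mul, WithZero.log_mul] <;> simp [ord, hf, hg]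

theorem ord_inv (P : PrimeDivisor A) (f : FractionRing A) : P.ord f⁻¹ = - P.ord f := by
  simp [ord]

theorem le_ord_add (P : PrimeDivisor A) {f g : FractionRing A} (hf : f ≠ 0) (hg : g ≠ 0)
    (hfg : f + g ≠ 0) {n : ℤ} (h1 : n ≤ P.ord f) (h2 : n ≤ P.ord g) : n ≤ P.ord (f + g) := by
  have h := Ring.ordFrac_add (R := P.LocalRing) f g hfg
  have hf' : Ring.ordFrac P.LocalRing f ≠ 0 := by simpa
  have hg' : Ring.ordFrac P.LocalRing g ≠ 0 := by simpa
  have hfg' : Ring.ordFrac P.LocalRing (f + g) ≠ 0 := by simpa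
  unfold ord at *
  rw [WithZero.le_log_iff_exp_le hf'] at h1
  rw [WithZero.le_log_iff_exp_le hg'] at h2
  rw [WithZero.le_log_iff_exp_le hfg']
  exact (le_min h1 h2).trans h

theorem ord_algebraMap (P : PrimeDivisor A) {K : Type*} [Field K] [Algebra K A] {c : K}
    (hc : c ≠ 0) : P.ord (algebraMap A (FractionRing A) (algebraMap K A c)) = 0 := by
  rw [IsScalarTower.algebraMap_apply A P.LocalRing (FractionRing A), ord,
    Ring.ordFrac_of_isUnit]
  · simp
  · exact ((hc.isUnit).map (algebraMap K A)).map _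

end PrimeDivisor

/-- Weil divisors: formal integral combinations of prime divisors. -/
abbrev WeilDivisor (A : Type*) [CommRing A] : Type _ := PrimeDivisor A →₀ ℤ

section Divisors

variable {A : Type*} [CommRing A] [IsDomain A] [IsNoetherianRing A] [IsIntegrallyClosed A]

/-- `D` is the divisor `(f)` of the nonzero rational function `f`. -/
def IsDivisorOf (f : FractionRing A) (D : WeilDivisor A) : Prop :=
  f ≠ 0 ∧ ∀ P : PrimeDivisor A, D P = P.ord f

variable (A) in
/-- The subgroup of principal divisors. -/
def principalDivisors : AddSubgroup (WeilDivisor A) where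
  carrier := {D | ∃ f : FractionRing A, IsDivisorOf f D}
  zero_mem' := ⟨1, one_ne_zero, fun P => by simp [P.ord_one]⟩
  add_mem' := by
    rintro D D' ⟨f, hf, hD⟩ ⟨g, hg, hD'⟩
    exact ⟨f * g, mul_ne_zero hf hg, fun P => by
      rw [P.ord_mul hf hg, Finsupp.add_apply, hD, hD']⟩
  neg_mem' := by
    rintro D ⟨f, hf, hD⟩
    exact ⟨f⁻¹, inv_ne_zero hf, fun P => by rw [P.ord_inv, Finsupp.neg_apply, hD]⟩

variable (A) in
/-- The divisor class group `Cl(X)`. -/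
abbrev DivisorClassGroup : Type _ := WeilDivisor A ⧸ principalDivisors A

/-- The class of a divisor in `Cl(X)`. -/
def divisorClass (D : WeilDivisor A) : DivisorClassGroup A := QuotientAddGroup.mk D

/-- The space `H⁰(X, D)` of rational functions `f` with `f = 0` or `(f) + D ≥ 0`. -/
def H0 (K : Type*) [Field K] [Algebra K A] (D : WeilDivisor A) :
    Submodule K (FractionRing A) where
  carrier := {f | f ≠ 0 → ∀ P : PrimeDivisor A, 0 ≤ P.ord f + D P}
  zero_mem' := fun h => (h rfl).elim
  add_mem' := by
    intro f g hf hg hfg P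
    by_cases hf0 : f = 0
    · subst hf0
      rw [zero_add] at hfg ⊢
      exact hg hfg P
    by_cases hg0 : g = 0
    · subst hg0
      rw [add_zero] at hfg ⊢
      exact hf hfg P
    have := P.le_ord_add hf0 hg0 hfg (n := -D P) (by linarith [hf hf0 P]) (by linarith [hg hg0 P])
    linarith
  smul_mem' := by
    intro c f hf hcf P
    have hc : c ≠ 0 := by
      rintro rfl
      exact hcf (zero_smul K f)
    have hf0 : f ≠ 0 := by
      rintro rfl
      exact hcf (smul_zero c)
    have h1 : c • f = algebraMap A (FractionRing A) (algebraMap K A c) * f := by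
      rw [← IsScalarTower.algebraMap_apply, Algebra.smul_def]
    have h2 : algebraMap A (FractionRing A) (algebraMap K A c) ≠ 0 := by
      rw [← IsScalarTower.algebraMap_apply]
      simpa using hc
    rw [h1, P.ord_mul h2 hf0, P.ord_algebraMap hc, zero_add]
    exact hf hf0 P

end Divisors

/-! ### The generalized total coordinate ring -/

/-- The choices made in the construction of `S(X)`: a decomposition
`Cl(X) ≅ ℤⁿ ⊕ ℤ/k₁ ⊕ ⋯ ⊕ ℤ/kₛ`, divisors `E i` and `W j` whose classes are the corresponding
generators, and rational functions `F j` with `(F j) = k j • W j`. -/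
structure ClassGroupSplitting (A : Type*) [CommRing A] [IsDomain A] [IsNoetherianRing A]
    [IsIntegrallyClosed A] where
  n : ℕ
  s : ℕ
  k : Fin s → ℕ
  k_neZero : ∀ j, NeZero (k j)
  equiv : ((Fin n → ℤ) × ((j : Fin s) → ZMod (k j))) ≃+ DivisorClassGroup A
  E : Fin n → WeilDivisor A
  W : Fin s → WeilDivisor A
  class_E : ∀ i, divisorClass (E i) = equiv (Pi.single i 1, 0)
  class_W : ∀ j, divisorClass (W j) = equiv (0, Pi.single j 1)
  F : Fin s → FractionRing A
  div_F : ∀ j, IsDivisorOf (F j) (k j • W j)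

namespace ClassGroupSplitting

variable {A : Type*} [CommRing A] [IsDomain A] [IsNoetherianRing A] [IsIntegrallyClosed A]
variable (𝒮 : ClassGroupSplitting A)

/-- The grading group `ℤⁿ ⊕ ℤ/k₁ ⊕ ⋯ ⊕ ℤ/kₛ` of `S(X)`. -/
abbrev Degree : Type := (Fin 𝒮.n → ℤ) × ((j : Fin 𝒮.s) → ZMod (𝒮.k j))

/-- The divisor `∑ λᵢ Eᵢ + ∑ μⱼ Wⱼ` with `0 ≤ μⱼ < kⱼ` attached to a degree. -/
def rep (g : 𝒮.Degree) : WeilDivisor A :=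
  ∑ i, g.1 i • 𝒮.E i + ∑ j, (g.2 j).val • 𝒮.W j

/-- The integer `⌊(b j + d j) / k j⌋` for the representatives `0 ≤ b j, d j < k j`. -/
def carry (g h : 𝒮.Degree) (j : Fin 𝒮.s) : ℕ := ((g.2 j).val + (h.2 j).val) / 𝒮.k j

/-- The correction factor `∏ j, F j ^ ⌊(b j + d j) / k j⌋`. -/
def correction (g h : 𝒮.Degree) : FractionRing A := ∏ j, 𝒮.F j ^ 𝒮.carry g h j

variable (K : Type*) [Field K] [Algebra K A]

/-- The homogeneous component of `S(X)` of a given degree. -/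
abbrev Component (g : 𝒮.Degree) : Type _ := H0 K (𝒮.rep g)

open scoped DirectSum in
/-- The total coordinate ring `S(X)`, as the direct sum of its homogeneous components. -/
abbrev TotalCoordinateRing : Type _ := ⨁ g : 𝒮.Degree, 𝒮.Component K g

theorem val_add_carry (g h : 𝒮.Degree) (j : Fin 𝒮.s) :
    ((g + h).2 j).val + 𝒮.k j * 𝒮.carry g h j = (g.2 j).val + (h.2 j).val := by
  have := 𝒮.k_neZero j
  rw [Prod.snd_add, Pi.add_apply, ZMod.val_add]
  exact Nat.mod_add_div _ _

theorem correction_ne_zero (g h : 𝒮.Degree) : 𝒮.correction g h ≠ 0 :=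
  Finset.prod_ne_zero_iff.mpr fun j _ => pow_ne_zero _ (𝒮.div_F j).1

theorem carry_comm (g h : 𝒮.Degree) (j : Fin 𝒮.s) : 𝒮.carry g h j = 𝒮.carry h g j := by
  rw [carry, carry, add_comm]

theorem carry_assoc (g h l : 𝒮.Degree) (j : Fin 𝒮.s) :
    𝒮.carry g h j + 𝒮.carry (g + h) l j = 𝒮.carry h l j + 𝒮.carry g (h + l) j := by
  have hk : 0 < 𝒮.k j := Nat.pos_of_ne_zero (𝒮.k_neZero j).out
  have h1 := 𝒮.val_add_carry g h j
  have h2 := 𝒮.val_add_carry (g + h) l j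
  have h3 := 𝒮.val_add_carry h l j
  have h4 := 𝒮.val_add_carry g (h + l) j
  rw [← add_assoc g h l] at h4
  apply Nat.eq_of_mul_eq_mul_left hk
  rw [mul_add, mul_add]
  omega

theorem carry_zero_left (g : 𝒮.Degree) (j : Fin 𝒮.s) : 𝒮.carry 0 g j = 0 := by
  have := 𝒮.k_neZero j
  simp [carry, Nat.div_eq_of_lt (ZMod.val_lt (g.2 j))]

theorem correction_comm (g h : 𝒮.Degree) : 𝒮.correction g h = 𝒮.correction h g := by
  simp only [correction, 𝒮.carry_comm g h]

theorem correction_assoc (g h l : 𝒮.Degree) :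
    𝒮.correction g h * 𝒮.correction (g + h) l = 𝒮.correction h l * 𝒮.correction g (h + l) := by
  simp only [correction, ← Finset.prod_mul_distrib, ← pow_add, 𝒮.carry_assoc g h l]

theorem correction_zero_left (g : 𝒮.Degree) : 𝒮.correction 0 g = 1 := by
  simp [correction, 𝒮.carry_zero_left]

theorem ord_prod_pow (P : PrimeDivisor A) (t : Finset (Fin 𝒮.s)) (c : Fin 𝒮.s → ℕ) :
    P.ord (∏ j ∈ t, 𝒮.F j ^ c j) = ∑ j ∈ t, (c j : ℤ) * (𝒮.k j * 𝒮.W j P) := by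
  induction t using Finset.cons_induction with
  | empty => simp [P.ord_one]
  | cons j t hj ih =>
    have hF := (𝒮.div_F j).1
    rw [Finset.prod_cons, Finset.sum_cons, P.ord_mul (pow_ne_zero _ hF)
      (Finset.prod_ne_zero_iff.mpr fun i _ => pow_ne_zero _ (𝒮.div_F i).1), ih]
    congr 1
    have h1 := (𝒮.div_F j).2 P
    rw [Finsupp.smul_apply, nsmul_eq_mul] at h1
    rw [PrimeDivisor.ord, map_pow, WithZero.log_pow, nsmul_eq_mul, h1, PrimeDivisor.ord]

theorem ord_correction (P : PrimeDivisor A) (g h : 𝒮.Degree) :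
    P.ord (𝒮.correction g h) + 𝒮.rep (g + h) P = 𝒮.rep g P + 𝒮.rep h P := by
  have key : ∀ j, (((g + h).2 j).val : ℤ) = (g.2 j).val + (h.2 j).val
      - 𝒮.k j * 𝒮.carry g h j := fun j => by
    have := 𝒮.val_add_carry g h j
    zify at this
    linarith
  rw [correction, ord_prod_pow]
  simp only [rep, Finsupp.add_apply, Finsupp.finsetSum_apply, Finsupp.smul_apply, nsmul_eq_mul,
    key, Prod.fst_add, Pi.add_apply, smul_eq_mul]
  have e1 : ∑ j, (((g.2 j).val : ℤ) + (h.2 j).val - 𝒮.k j * 𝒮.carry g h j) * 𝒮.W j P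
      = ∑ j, ((g.2 j).val : ℤ) * 𝒮.W j P + ∑ j, ((h.2 j).val : ℤ) * 𝒮.W j P
        - ∑ j, (𝒮.carry g h j : ℤ) * (𝒮.k j * 𝒮.W j P) := by
    rw [← Finset.sum_add_distrib, ← Finset.sum_sub_distrib]
    exact Finset.sum_congr rfl fun j _ => by ring
  have e2 : ∑ i, (g.1 i + h.1 i) * 𝒮.E i P = ∑ i, g.1 i * 𝒮.E i P + ∑ i, h.1 i * 𝒮.E i P := by
    rw [← Finset.sum_add_distrib]
    exact Finset.sum_congr rfl fun j _ => by ring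
  rw [e1, e2]
  ring

theorem mul_mem (g h : 𝒮.Degree) {a b : FractionRing A} (ha : a ∈ H0 K (𝒮.rep g))
    (hb : b ∈ H0 K (𝒮.rep h)) : a * b * 𝒮.correction g h ∈ H0 K (𝒮.rep (g + h)) := by
  intro h0 P
  have ha0 : a ≠ 0 := fun h' => h0 (by rw [h', zero_mul, zero_mul])
  have hb0 : b ≠ 0 := fun h' => h0 (by rw [h', mul_zero, zero_mul])
  have h1 := ha ha0 P
  have h2 := hb hb0 P
  have h3 := 𝒮.ord_correction P g h
  rw [P.ord_mul (mul_ne_zero ha0 hb0) (𝒮.correction_ne_zero g h), P.ord_mul ha0 hb0]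
  linarith

theorem rep_zero : 𝒮.rep 0 = 0 := by
  have : ∀ j, ((0 : 𝒮.Degree).2 j).val = 0 := fun j => by
    have := 𝒮.k_neZero j
    simp
  simp [rep]

theorem algebraMap_mem (c : K) : algebraMap K (FractionRing A) c ∈ H0 K (𝒮.rep 0) := by
  have h1 : (1 : FractionRing A) ∈ H0 K (𝒮.rep 0) := fun _ P => by
    rw [𝒮.rep_zero, P.ord_one]
    simp
  rw [Algebra.algebraMap_eq_smul_one]
  exact Submodule.smul_mem _ c h1

/-- The inclusion of the constants into the component of degree zero. -/
def const : K →+ 𝒮.Component K 0 where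
  toFun c := ⟨algebraMap K (FractionRing A) c, 𝒮.algebraMap_mem K c⟩
  map_zero' := Subtype.ext (map_zero _)
  map_add' _ _ := Subtype.ext (map_add _ _ _)

/-- The product `f * g = f g ∏ F j ^ ⌊(b j + d j) / k j⌋` of homogeneous elements. -/
instance : GradedMonoid.GMul (𝒮.Component K) where
  mul {g h} a b := ⟨a.1 * b.1 * 𝒮.correction g h, 𝒮.mul_mem K g h a.2 b.2⟩

instance : GradedMonoid.GOne (𝒮.Component K) where
  one := 𝒮.const K 1

/-- `S(X)` is a commutative ring graded by the divisor class group. -/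
instance : DirectSum.GCommRing (𝒮.Component K) where
  mul_zero a := Subtype.ext (by simp [GradedMonoid.GMul.mul])
  zero_mul a := Subtype.ext (by simp [GradedMonoid.GMul.mul])
  mul_add a b c := Subtype.ext (by simp [GradedMonoid.GMul.mul]; ring)
  add_mul a b c := Subtype.ext (by simp [GradedMonoid.GMul.mul]; ring)
  one_mul := fun ⟨g, a⟩ => Sigma.subtype_ext (zero_add g) (by
    change algebraMap K (FractionRing A) 1 * a.1 * 𝒮.correction 0 g = a.1
    rw [𝒮.correction_zero_left, map_one, one_mul, mul_one])
  mul_one := fun ⟨g, a⟩ => Sigma.subtype_ext (add_zero g) (by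
    change a.1 * algebraMap K (FractionRing A) 1 * 𝒮.correction g 0 = a.1
    rw [𝒮.correction_comm, 𝒮.correction_zero_left, map_one, mul_one, mul_one])
  mul_assoc := fun ⟨g, a⟩ ⟨h, b⟩ ⟨l, c⟩ => Sigma.subtype_ext (add_assoc g h l) (by
    change a.1 * b.1 * 𝒮.correction g h * c.1 * 𝒮.correction (g + h) l
      = a.1 * (b.1 * c.1 * 𝒮.correction h l) * 𝒮.correction g (h + l)
    linear_combination a.1 * b.1 * c.1 * 𝒮.correction_assoc g h l)
  mul_comm := fun ⟨g, a⟩ ⟨h, b⟩ => Sigma.subtype_ext (add_comm g h) (by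
    change a.1 * b.1 * 𝒮.correction g h = b.1 * a.1 * 𝒮.correction h g
    rw [𝒮.correction_comm g h, mul_comm a.1 b.1])
  natCast m := 𝒮.const K m
  natCast_zero := by simp
  natCast_succ m := by
    rw [Nat.cast_succ, map_add]
    rfl
  intCast m := 𝒮.const K m
  intCast_ofNat m := by simp
  intCast_negSucc_ofNat m := by rw [Int.cast_negSucc, map_neg]

/-- `S(X)` is a `K`-algebra. -/
instance : DirectSum.GAlgebra K (𝒮.Component K) where
  toFun := 𝒮.const K
  map_one := rfl
  map_mul c d := Sigma.subtype_ext (zero_add 0).symm (by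
    change algebraMap K (FractionRing A) (c * d)
      = algebraMap K (FractionRing A) c * algebraMap K (FractionRing A) d * 𝒮.correction 0 0
    rw [𝒮.correction_zero_left, map_mul, mul_one])
  commutes c := fun ⟨g, a⟩ => Sigma.subtype_ext (by
    change 0 + g = g + 0
    rw [add_comm]) (by
    change algebraMap K (FractionRing A) c * a.1 * 𝒮.correction 0 g
      = a.1 * algebraMap K (FractionRing A) c * 𝒮.correction g 0
    rw [𝒮.correction_comm 0 g, mul_comm a.1])
  smul_def c := fun ⟨g, a⟩ => Sigma.subtype_ext (zero_add g).symm (by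
    change c • a.1 = algebraMap K (FractionRing A) c * a.1 * 𝒮.correction 0 g
    rw [𝒮.correction_zero_left, mul_one, Algebra.smul_def])

end ClassGroupSplitting

/-! ### Torus actions on affine varieties -/

/-- The character `χᵐ` of the torus `(Kˣ)ʳ` given by `m ∈ M = ℤʳ`. -/
def torusCharacter {K : Type*} [Field K] {r : ℕ} (m : Fin r → ℤ) (t : Fin r → Kˣ) : Kˣ :=
  ∏ i, t i ^ m i

/-- A regular action of the torus `T = (Kˣ)ʳ` on the affine variety `X` with coordinate ring `A`,
given by the pullbacks `f ↦ (x ↦ f (t · x))`.  Regularity of `T × X → X` says that every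
`f (t · x)` is a finite sum `∑ χᵐ(t) fₘ(x)`. -/
structure TorusAction (K : Type*) [Field K] (r : ℕ) (A : Type*) [CommRing A] [Algebra K A] where
  act : (Fin r → Kˣ) →* (A ≃ₐ[K] A)
  regular : ∀ a : A, ∃ p : (Fin r → ℤ) →₀ A, ∀ t : Fin r → Kˣ,
    act t a = p.sum fun m b => (torusCharacter m t : K) • b

namespace TorusAction

variable {K : Type*} [Field K] {r : ℕ} {A : Type*} [CommRing A] [Algebra K A]
variable (T : TorusAction K r A)

/-- The orbit of the (closed) point `x` under the torus: the ideal of functions vanishing at `t · x`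
is the preimage of the ideal of `x` under the pullback by `t`. -/
def orbit (x : MaximalSpectrum A) : Set (MaximalSpectrum A) :=
  {y | ∃ t, y.asIdeal = x.asIdeal.comap (T.act t : A →+* A)}

/-- The action is locally transitive: some orbit is Zariski open. -/
def LocallyTransitive : Prop := ∃ x : MaximalSpectrum A, IsOpen (T.orbit x)

/-- The action is effective: only the neutral element of `T` acts trivially. -/
def Effective : Prop := Function.Injective T.act

/-- `a` is a semi-invariant function of weight `m`, that is, `a (t · x) = χᵐ(t) a(x)`. -/
def IsWeightVector (m : Fin r → ℤ) (a : A) : Prop :=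
  ∀ t, T.act t a = (torusCharacter m t : K) • a

/-- The weight semigroup of `K[X]`, in `M_ℚ = ℚʳ`. -/
def weights : Set (Fin r → ℚ) :=
  {v | ∃ (m : Fin r → ℤ) (a : A), a ≠ 0 ∧ T.IsWeightVector m a ∧ v = fun i => (m i : ℚ)}

/-- The cone `σ` of the toric variety in `N_ℚ = ℚʳ`: the dual of the cone generated by the weights
of `K[X]`. -/
def cone : PointedCone ℚ (Fin r → ℚ) := PointedCone.dual (dotProductBilin ℚ ℚ) T.weights

/-- The set `Δ(1)` of one-dimensional faces of `σ`. -/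
def Ray : Type :=
  {ρ : PointedCone ℚ (Fin r → ℚ) //
    ρ.IsFaceOf T.cone ∧ Module.finrank ℚ (Submodule.span ℚ (ρ : Set (Fin r → ℚ))) = 1}

/-- The ideal of the closed `T`-stable subset `D_ρ` attached to the ray `ρ`: it is generated by the
weight vectors whose weight is positive on `ρ ∖ {0}`. -/
def rayIdeal (ρ : T.Ray) : Ideal A :=
  Ideal.span {a | ∃ m : Fin r → ℤ, T.IsWeightVector m a ∧
    ∃ v ∈ ρ.1, 0 < (fun i => (m i : ℚ)) ⬝ᵥ v}

/-- The prime divisor `P` is `T`-invariant. -/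
def Invariant (P : PrimeDivisor A) : Prop :=
  ∀ t, P.asIdeal.comap (T.act t : A →+* A) = P.asIdeal

end TorusAction

end

noncomputable section

/-! The open orbit is a copy of the torus, and every question about rational functions is reduced to
its characters. A weight vector vanishing at a point of the open orbit vanishes identically, so
weight spaces are at most one-dimensional; effectiveness makes the weights generate ℤʳ. Quotients of
weight vectors normalised at that point form a multiplicative, linearly independent family χᵐ
(`nonempty_characterSystem`, `linearIndependent`), and every regular function is a finite
combination of regular ones.

Three facts then carry the proof. First, a non-invariant prime divisor gives every χᵐ order zero, so
by algebraic Hartogs χᵐ is regular exactly when its order along each invariant prime divisor is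
nonnegative (`mem_regular_iff`). By Farkas' lemma the cone σ is generated by the vectors of these
orders, each of which spans a ray: this is the bijection between rays and invariant primes. Second,
the coordinate ring of the torus is a localised polynomial ring, hence factorial, so every divisor
agrees off the invariant primes with a principal one (`exists_ord_eq_of_not_invariant`); thus Cl(X)
is generated by the finitely many invariant classes. Third, since invertible functions are constant,
the divisor of a rational function determines it up to a scalar (`PrimeDivisor.eq_smul_of_ord_eq`).

For the comparison, send x_ρ to a homogeneous element of S(X) whose divisor of zeros is D_ρ. The
factors F_j are exactly what makes divisors of zeros add under the twisted product, so a monomial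
goes to an element with the corresponding invariant divisor of zeros. In degree g, choose h agreeing
with the divisor `rep g` on the open orbit: multiplication by h turns H⁰ into a span of characters,
and these characters match the effective invariant divisors of class g, that is, the monomials of
degree g. Expansion in characters gives surjectivity (`range_lof_le`), their independence gives
injectivity (`coxHom_injective`). -/

theorem Ideal.IsPrime.eq_of_le_of_height_eq_one {A : Type*} [CommRing A] [IsDomain A]
    [IsNoetherianRing A] {p q : Ideal A} (hp : p.IsPrime) (hqh : q.height = 1)
    (hne : p ≠ ⊥) (hle : p ≤ q) : p = q := by
  refine Ideal.eq_of_le_of_height_le p hle ?_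
  rw [hqh, Order.one_le_iff_ne_zero, Ne, Ideal.height_eq_zero_iff_eq_bot]
  exact hne

/-! ### Orders of vanishing and algebraic Hartogs. -/

namespace PrimeDivisor

variable {A : Type*} [CommRing A]

theorem ne_bot [IsDomain A] (P : PrimeDivisor A) : P.asIdeal ≠ ⊥ :=
  Ideal.ne_bot_of_height_eq_one P.height_eq

variable [IsDomain A] [IsNoetherianRing A] [IsIntegrallyClosed A]

local notation "ι" => algebraMap A (FractionRing A)

theorem ord_pow (P : PrimeDivisor A) (f : FractionRing A) (n : ℕ) :
    P.ord (f ^ n) = n * P.ord f := by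
  rw [ord, map_pow, WithZero.log_pow, nsmul_eq_mul, ord]

theorem ord_zpow (P : PrimeDivisor A) (f : FractionRing A) (n : ℤ) :
    P.ord (f ^ n) = n * P.ord f := by
  rw [ord, map_zpow₀, WithZero.log_zpow, smul_eq_mul, ord]

theorem ord_div (P : PrimeDivisor A) {f g : FractionRing A} (hf : f ≠ 0) (hg : g ≠ 0) :
    P.ord (f / g) = P.ord f - P.ord g := by
  rw [div_eq_mul_inv, P.ord_mul hf (inv_ne_zero hg), P.ord_inv, sub_eq_add_neg]

theorem ord_prod (P : PrimeDivisor A) {κ : Type*} (t : Finset κ) (f : κ → FractionRing A)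
    (hf : ∀ j ∈ t, f j ≠ 0) : P.ord (∏ j ∈ t, f j) = ∑ j ∈ t, P.ord (f j) := by
  induction t using Finset.cons_induction with
  | empty => simp [P.ord_one]
  | cons j t hj ih =>
    rw [Finset.prod_cons, Finset.sum_cons, P.ord_mul (hf j (by simp))
      (Finset.prod_ne_zero_iff.mpr fun i hi => hf i (by simp [hi])),
      ih fun i hi => hf i (by simp [hi])]

theorem ord_algebraMap_nonneg (P : PrimeDivisor A) (a : A) : 0 ≤ P.ord (ι a) := by
  by_cases ha : a = 0
  · simp [ha, ord]
  have h : algebraMap A P.LocalRing a ≠ 0 := by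
    rw [Ne, FaithfulSMul.algebraMap_eq_zero_iff]; exact ha
  rw [IsScalarTower.algebraMap_apply A P.LocalRing (FractionRing A), ord,
    WithZero.le_log_iff_exp_le (by simpa using ha)]
  simpa using Ring.ordFrac_ge_one_of_ne_zero (K := FractionRing A) h

theorem ord_algebraMap_eq_zero_iff (P : PrimeDivisor A) {a : A} (ha : a ≠ 0) :
    P.ord (ι a) = 0 ↔ a ∉ P.asIdeal := by
  rw [IsScalarTower.algebraMap_apply A P.LocalRing (FractionRing A), ord]
  have h : algebraMap A P.LocalRing a ≠ 0 := by
    rw [Ne, FaithfulSMul.algebraMap_eq_zero_iff]; exact ha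
  have h1 : Ring.ordFrac P.LocalRing (algebraMap P.LocalRing (FractionRing A)
      (algebraMap A P.LocalRing a)) ≠ 0 := by simpa using ha
  have h2 := IsLocalization.AtPrime.isUnit_to_map_iff P.LocalRing P.asIdeal a
  rw [Ring.isUnit_iff_ordFrac_one_of_isDiscreteValuationRing (K := FractionRing A)] at h2
  rw [← Ideal.mem_primeCompl_iff, ← h2, ← WithZero.exp_zero, ← WithZero.exp_log h1,
    WithZero.log_exp, WithZero.exp_inj]

theorem ord_algebraMap_pos_iff (P : PrimeDivisor A) {a : A} (ha : a ≠ 0) :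
    0 < P.ord (ι a) ↔ a ∈ P.asIdeal := by
  have h1 := P.ord_algebraMap_nonneg a
  have h2 := P.ord_algebraMap_eq_zero_iff ha
  constructor
  · intro h
    by_contra h3
    exact h.ne' (h2.mpr h3)
  · intro h
    exact lt_of_le_of_ne h1 fun h3 => h2.mp h3.symm h

theorem exists_mul_eq_of_ord_nonneg (P : PrimeDivisor A) {f : FractionRing A} (hf : 0 ≤ P.ord f) :
    ∃ s ∉ P.asIdeal, ∃ b : A, ι s * f = ι b := by
  by_cases hf0 : f = 0
  · exact ⟨1, fun h => P.isPrime.ne_top ((Ideal.eq_top_iff_one _).mpr h), 0, by simp [hf0]⟩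
  have h1 : Ring.ordFrac P.LocalRing f ≠ 0 := by simpa
  have h2 : 1 ≤ Ring.ordFrac P.LocalRing f := by
    rw [ord, WithZero.le_log_iff_exp_le h1] at hf
    simpa using hf
  rw [Ring.ordFrac_eq_valuation_inv, one_le_inv₀ (by simpa [zero_lt_iff] using hf0)] at h2
  obtain ⟨x, hx⟩ := IsDiscreteValuationRing.exists_lift_of_le_one h2
  obtain ⟨b, s, rfl⟩ := IsLocalization.exists_mk'_eq P.asIdeal.primeCompl x
  refine ⟨s, s.2, b, ?_⟩
  rw [← hx, IsScalarTower.algebraMap_apply A P.LocalRing (FractionRing A),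
    IsScalarTower.algebraMap_apply A P.LocalRing (FractionRing A), ← map_mul,
    IsLocalization.mk'_spec']

theorem exists_ord_eq_one (P : PrimeDivisor A) : ∃ a ∈ P.asIdeal, P.ord (ι a) = 1 := by
  obtain ⟨ϖ, hϖ⟩ := IsDiscreteValuationRing.exists_irreducible P.LocalRing
  obtain ⟨a, s, rfl⟩ := IsLocalization.exists_mk'_eq P.asIdeal.primeCompl ϖ
  have h1 : Ring.ordFrac P.LocalRing (algebraMap P.LocalRing (FractionRing A)
      (algebraMap A P.LocalRing a)) = WithZero.exp 1 := by
    rw [← IsLocalization.mk'_spec P.LocalRing a s, map_mul, map_mul, Ring.ordFrac_irreducible hϖ,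
      Ring.ordFrac_of_isUnit (IsLocalization.map_units _ s), mul_one]
  have h2 : P.ord (ι a) = 1 := by
    rw [IsScalarTower.algebraMap_apply A P.LocalRing (FractionRing A), ord, h1]
    simp
  have ha : a ≠ 0 := by
    rintro rfl
    simp [ord] at h2
  exact ⟨a, (P.ord_algebraMap_pos_iff ha).mp (by omega), h2⟩

theorem asIdeal_injective : Function.Injective fun P : PrimeDivisor A => P.asIdeal :=
  fun _ _ h => PrimeDivisor.ext h

/-- A prime divisor is determined by inclusion. -/
theorem eq_of_le {P Q : PrimeDivisor A} (h : P.asIdeal ≤ Q.asIdeal) : P = Q :=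
  asIdeal_injective (P.isPrime.eq_of_le_of_height_eq_one Q.height_eq P.ne_bot h)

theorem finite_mem {a : A} (ha : a ≠ 0) : {P : PrimeDivisor A | a ∈ P.asIdeal}.Finite := by
  refine Set.Finite.of_finite_image (f := fun P : PrimeDivisor A => P.asIdeal)
    (((Ideal.span {a}).finite_minimalPrimes_of_isNoetherianRing A).subset ?_)
    asIdeal_injective.injOn
  rintro _ ⟨P, hP, rfl⟩
  refine ⟨⟨P.isPrime, (Ideal.span_singleton_le_iff_mem _).mpr hP⟩, ?_⟩
  rintro q ⟨hq, hq1⟩ hle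
  refine (hq.eq_of_le_of_height_eq_one P.height_eq ?_ hle).ge
  rintro rfl
  exact ha (by simpa using hq1)

theorem finite_ord_ne_zero (f : FractionRing A) : {P : PrimeDivisor A | P.ord f ≠ 0}.Finite := by
  obtain ⟨a, b, hb, rfl⟩ := IsFractionRing.div_surjective (A := A) f
  have hb0 : b ≠ 0 := nonZeroDivisors.ne_zero hb
  by_cases ha : a = 0
  · simp [ha, ord]
  refine ((finite_mem ha).union (finite_mem hb0)).subset fun P hP => ?_
  by_contra h
  simp only [Set.mem_union, Set.mem_ofPred_eq, not_or] at h
  apply hP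
  rw [P.ord_div (by simpa using ha) (by simpa using hb0), (P.ord_algebraMap_eq_zero_iff ha).mpr h.1,
    (P.ord_algebraMap_eq_zero_iff hb0).mpr h.2, sub_zero]

/-- Algebraic Hartogs: a rational function without poles in codimension one is regular. -/
theorem mem_range_of_ord_nonneg {f : FractionRing A} (hf : ∀ P : PrimeDivisor A, 0 ≤ P.ord f) :
    ∃ a : A, ι a = f := by
  by_contra hfA
  let N : Submodule A (FractionRing A) := LinearMap.range (Algebra.linearMap A (FractionRing A))
  have hN : ∀ g, g ∈ N ↔ ∃ a : A, ι a = g := fun g => Iff.rfl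
  -- The ideal of denominators of `f` lies in an associated prime `p` of Frac(A)/A; below, `g`
  -- represents a class whose annihilator is exactly `p`.
  obtain ⟨p, hp, hle⟩ := exists_le_isAssociatedPrime_of_isNoetherianRing A (N.mkQ f) (by
    rw [Ne, Submodule.mkQ_apply, Submodule.Quotient.mk_eq_zero, hN]
    exact hfA)
  obtain ⟨hpp, x, hx⟩ := isAssociatedPrime_iff.mp hp
  obtain ⟨g, rfl⟩ := N.mkQ_surjective x
  have hg : ∀ a : A, a ∈ p ↔ ∃ b : A, ι b = ι a * g := fun a => by
    rw [hx, Submodule.mem_colon_singleton, ← map_smul, Submodule.mem_bot, Submodule.mkQ_apply,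
      Submodule.Quotient.mk_eq_zero, hN, Algebra.smul_def]
  have hp1 : p ≠ ⊥ := by
    obtain ⟨a, b, hb, rfl⟩ := IsFractionRing.div_surjective (A := A) g
    have hb0 : ι b ≠ 0 := by simpa using nonZeroDivisors.ne_zero hb
    exact fun h => hb0 (by
      simpa [h] using (hg b).mpr ⟨a, by rw [mul_div_cancel₀ _ hb0]⟩)
  have hga : ¬ ∃ b, ι b = g := fun h =>
    hpp.ne_top ((Ideal.eq_top_iff_one _).mpr ((hg 1).mpr (by simpa using h)))
  -- Otherwise `g` maps the nonzero finitely generated ideal `p` into itself, so it is integral over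
  -- `A`, hence in `A` by normality.
  obtain ⟨p0, hp0, u, hu, hup⟩ : ∃ p0 ∈ p, ∃ u : A, ι u = ι p0 * g ∧ u ∉ p := by
    by_contra! hcon
    refine hga (IsIntegrallyClosed.isIntegral_iff.mp
      (isIntegral_of_smul_mem_submodule (Submodule.map (Algebra.linearMap A (FractionRing A)) p) ?_
        ((IsNoetherian.noetherian p).map _) g ?_))
    · refine fun h => hp1 (Submodule.map_injective_of_injective (f := Algebra.linearMap A
        (FractionRing A)) (FaithfulSMul.algebraMap_injective A (FractionRing A)) ?_)
      rw [h, Submodule.map_bot]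
    · rintro _ ⟨a, ha, rfl⟩
      obtain ⟨b, hb⟩ := (hg a).mp ha
      exact ⟨b, hcon a ha b hb, by simp [hb, mul_comm]⟩
  -- For `a ∈ p`, the product `u * a` is a multiple of `p0` while `u ∉ p`; so any prime below `p`
  -- containing `p0` contains `a`. Krull's principal ideal theorem then gives height one, and the
  -- hypothesis on `f` applies to `p` itself.
  have hmin : p ∈ (Ideal.span {p0}).minimalPrimes := by
    refine ⟨⟨hpp, (Ideal.span_singleton_le_iff_mem _).mpr hp0⟩, ?_⟩
    rintro q ⟨hq, hq1⟩ hqp a ha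
    obtain ⟨b, hb⟩ := (hg a).mp ha
    have h1 : u * a = p0 * b := by
      apply FaithfulSMul.algebraMap_injective A (FractionRing A)
      rw [map_mul, map_mul, hb, hu]
      ring
    refine (hq.mem_or_mem (x := u) (y := a) ?_).resolve_left fun h => hup (hqp h)
    rw [h1]
    exact q.mul_mem_right _ ((Ideal.span_singleton_le_iff_mem _).mp hq1)
  have hh : p.height = 1 := by
    refine le_antisymm (Ideal.height_le_one_of_isPrincipal_of_mem_minimalPrimes _ p hmin) ?_
    rwa [Order.one_le_iff_ne_zero, Ne, Ideal.height_eq_zero_iff_eq_bot]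
  obtain ⟨s, hs, b, hb⟩ := exists_mul_eq_of_ord_nonneg ⟨⟨p, hpp⟩, hh⟩ (hf ⟨⟨p, hpp⟩, hh⟩)
  refine hs (hle ?_)
  rw [Submodule.mem_colon_singleton, ← map_smul, Submodule.mem_bot, Submodule.mkQ_apply,
    Submodule.Quotient.mk_eq_zero, hN, Algebra.smul_def]
  exact ⟨b, hb.symm⟩

theorem exists_algebraMap_eq_of_ord_eq_zero {f : FractionRing A} (hf0 : f ≠ 0)
    (hf : ∀ P : PrimeDivisor A, P.ord f = 0) : ∃ u : A, IsUnit u ∧ ι u = f := by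
  obtain ⟨a, ha⟩ := mem_range_of_ord_nonneg fun P => (hf P).ge
  obtain ⟨b, hb⟩ := mem_range_of_ord_nonneg (f := f⁻¹) fun P => by rw [P.ord_inv, hf P, neg_zero]
  refine ⟨a, IsUnit.of_mul_eq_one b ?_, ha⟩
  apply FaithfulSMul.algebraMap_injective A (FractionRing A)
  rw [map_mul, ha, hb, map_one, mul_inv_cancel₀ hf0]

/-- Rational functions whose order along `P` is at least `n`. -/
def filtration (P : PrimeDivisor A) (n : ℤ) : Submodule A (FractionRing A) where
  carrier := {f | f ≠ 0 → n ≤ P.ord f}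
  zero_mem' := fun h => (h rfl).elim
  add_mem' := by
    intro f g hf hg hfg
    by_cases hf0 : f = 0
    · subst hf0
      rw [zero_add] at hfg ⊢
      exact hg hfg
    by_cases hg0 : g = 0
    · subst hg0
      rw [add_zero] at hfg ⊢
      exact hf hfg
    exact P.le_ord_add hf0 hg0 hfg (hf hf0) (hg hg0)
  smul_mem' := by
    intro a f hf haf
    rw [Algebra.smul_def] at haf ⊢
    rw [P.ord_mul (left_ne_zero_of_mul haf) (right_ne_zero_of_mul haf)]
    linarith [P.ord_algebraMap_nonneg a, hf (right_ne_zero_of_mul haf)]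

theorem mem_filtration (P : PrimeDivisor A) {n : ℤ} {f : FractionRing A} :
    f ∈ P.filtration n ↔ (f ≠ 0 → n ≤ P.ord f) := Iff.rfl

theorem mem_filtration_of_ne_zero (P : PrimeDivisor A) {n : ℤ} {f : FractionRing A} (hf : f ≠ 0) :
    f ∈ P.filtration n ↔ n ≤ P.ord f := by
  simp [mem_filtration, hf]

theorem mul_mem_filtration (P : PrimeDivisor A) {n m : ℤ} {f g : FractionRing A}
    (hf : f ∈ P.filtration n) (hg : g ∈ P.filtration m) : f * g ∈ P.filtration (n + m) := by
  intro h
  rw [P.ord_mul (left_ne_zero_of_mul h) (right_ne_zero_of_mul h)]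
  exact add_le_add (hf (left_ne_zero_of_mul h)) (hg (right_ne_zero_of_mul h))

/-- With π of order one along P, write `s * a = b * π ^ n` with `s ∉ P`. Applying θ keeps `s`
outside P and π inside it, so the order cannot drop below `n`. This makes the symbolic powers of an
invariant prime stable under the torus. -/
theorem algebraMap_mem_filtration (P : PrimeDivisor A) (θ : A ≃+* A)
    (hθ : P.asIdeal.comap (θ : A →+* A) = P.asIdeal) {a : A} {n : ℕ}
    (ha : ι a ∈ P.filtration n) : ι (θ a) ∈ P.filtration n := by
  by_cases ha0 : a = 0
  · simp [ha0]
  have hθ0 : ∀ {b}, b ≠ 0 → θ b ≠ 0 := fun hb => by simpa using hb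
  have hmem : ∀ b, θ b ∈ P.asIdeal ↔ b ∈ P.asIdeal := fun b => by
    conv_rhs => rw [← hθ]
    rfl
  obtain ⟨π, hπ, hπ1⟩ := P.exists_ord_eq_one
  have hπ0 : π ≠ 0 := by
    rintro rfl
    simp [ord] at hπ1
  have hι : ∀ {b : A}, b ≠ 0 → ι b ≠ 0 := fun hb => by simpa using hb
  rw [P.mem_filtration_of_ne_zero (hι ha0)] at ha
  rw [P.mem_filtration_of_ne_zero (hι (hθ0 ha0))]
  obtain ⟨s, hs, b, hb⟩ := P.exists_mul_eq_of_ord_nonneg (f := ι a / ι π ^ n) (by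
    rw [P.ord_div (hι ha0) (pow_ne_zero _ (hι hπ0)), P.ord_pow, hπ1]
    linarith)
  have h1 : s * a = b * π ^ n := by
    apply FaithfulSMul.algebraMap_injective A (FractionRing A)
    have := hι hπ0
    rw [map_mul, map_mul, map_pow, ← hb]
    field_simp
  have hs0 : s ≠ 0 := by
    rintro rfl
    exact hs P.asIdeal.zero_mem
  have hb0 : b ≠ 0 := by
    rintro rfl
    rw [zero_mul, mul_eq_zero] at h1
    tauto
  have h2 : P.ord (ι (θ s)) + P.ord (ι (θ a)) = P.ord (ι (θ b)) + n * P.ord (ι (θ π)) := by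
    rw [← P.ord_mul (hι (hθ0 hs0)) (hι (hθ0 ha0)), ← P.ord_pow, ← P.ord_mul (hι (hθ0 hb0))
      (pow_ne_zero _ (hι (hθ0 hπ0)))]
    simp only [← map_mul, ← map_pow, h1]
  rw [(P.ord_algebraMap_eq_zero_iff (hθ0 hs0)).mpr (by rwa [hmem])] at h2
  have h3 : 0 < P.ord (ι (θ π)) := (P.ord_algebraMap_pos_iff (hθ0 hπ0)).mpr (by rwa [hmem])
  have h4 := P.ord_algebraMap_nonneg (θ b)
  nlinarith

end PrimeDivisor

section

variable {A : Type*} [CommRing A] [IsDomain A] [IsNoetherianRing A] [IsIntegrallyClosed A]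

theorem divisorClass_eq_iff {D D' : WeilDivisor A} :
    divisorClass D = divisorClass D' ↔
      ∃ f : FractionRing A, f ≠ 0 ∧ ∀ P : PrimeDivisor A, P.ord f = D P - D' P := by
  rw [divisorClass, divisorClass, QuotientAddGroup.eq_iff_sub_mem]
  constructor
  · rintro ⟨f, hf, h⟩
    exact ⟨f, hf, fun P => by rw [← h, Finsupp.sub_apply]⟩
  · rintro ⟨f, hf, h⟩
    exact ⟨f, hf, fun P => by rw [h, Finsupp.sub_apply]⟩

end

/-! ### Characters of the torus. -/

section TorusCharacter

variable {K : Type*} [Field K] {r : ℕ}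

theorem torusCharacter_mul (m : Fin r → ℤ) (s t : Fin r → Kˣ) :
    torusCharacter m (s * t) = torusCharacter m s * torusCharacter m t := by
  simp [torusCharacter, mul_zpow, Finset.prod_mul_distrib]

theorem torusCharacter_add (m n : Fin r → ℤ) (t : Fin r → Kˣ) :
    torusCharacter (m + n) t = torusCharacter m t * torusCharacter n t := by
  simp [torusCharacter, zpow_add, Finset.prod_mul_distrib]

@[simp]
theorem torusCharacter_zero (t : Fin r → Kˣ) : torusCharacter 0 t = 1 := by
  simp [torusCharacter]

@[simp]
theorem torusCharacter_one (m : Fin r → ℤ) : torusCharacter m (1 : Fin r → Kˣ) = 1 := by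
  simp [torusCharacter]

/-- The character `χᵐ` as a homomorphism into the multiplicative monoid of the base field. -/
def torusCharacterHom (K : Type*) [Field K] (m : Fin r → ℤ) : (Fin r → Kˣ) →* K where
  toFun t := torusCharacter m t
  map_one' := by simp
  map_mul' s t := by rw [torusCharacter_mul, Units.val_mul]

theorem torusCharacterHom_injective [CharZero K] :
    Function.Injective (torusCharacterHom K : (Fin r → ℤ) → ((Fin r → Kˣ) →* K)) := by
  intro m n h
  funext i
  -- The test point has 2 in coordinate `i` and 1 elsewhere; in characteristic zero the powers of 2
  -- are distinct.
  have h1 := DFunLike.congr_fun h (Pi.mulSingle i (Units.mk0 (2 : K) two_ne_zero))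
  have key : ∀ k : Fin r → ℤ, torusCharacterHom K k
      (Pi.mulSingle i (Units.mk0 (2 : K) two_ne_zero)) = ((2 : ℚ) ^ k i : ℚ) := by
    intro k
    rw [torusCharacterHom, MonoidHom.coe_mk, OneHom.coe_mk, torusCharacter,
      Finset.prod_eq_single i]
    · simp
    · intro j _ hj
      simp [Pi.mulSingle_eq_of_ne hj]
    · simp
  rw [key, key, Rat.cast_inj] at h1
  exact zpow_right_injective₀ (by norm_num) (by norm_num) h1

/-- Linear independence of the characters of a torus, with coefficients in a vector space. -/
theorem eq_zero_of_sum_torusCharacter_smul_eq_zero [CharZero K] {V : Type*} [AddCommGroup V]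
    [Module K V] (F : Finset (Fin r → ℤ)) (b : (Fin r → ℤ) → V)
    (h : ∀ t : Fin r → Kˣ, ∑ m ∈ F, (torusCharacter m t : K) • b m = 0) :
    ∀ m ∈ F, b m = 0 := by
  intro m hm
  -- Linear functionals reduce the vector-valued relation to Dedekind's independence of characters.
  rw [← Module.forall_dual_apply_eq_zero_iff K]
  intro φ
  have hli := (linearIndependent_monoidHom (Fin r → Kˣ) K).comp _
    (torusCharacterHom_injective (K := K) (r := r))
  refine linearIndependent_iff'.mp hli F (fun m => φ (b m)) ?_ m hm
  funext t
  simpa [torusCharacterHom, mul_comm] using congrArg φ (h t)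

theorem torusCharacter_eq_of_hom (h : (Fin r → ℤ) →+ Additive Kˣ) (m : Fin r → ℤ) :
    torusCharacter m (fun i => (h (Pi.single i 1)).toMul) = (h m).toMul := by
  conv_rhs => rw [← Finset.univ_sum_single m]
  rw [map_sum, toMul_sum, torusCharacter]
  refine Finset.prod_congr rfl fun i _ => ?_
  rw [← toMul_zsmul, ← map_zsmul, ← Pi.single_smul, smul_eq_mul, mul_one]

/-- A proper subgroup of the character lattice is killed by a nontrivial element of the torus. -/
theorem exists_torusCharacter_eq_one [IsAlgClosed K] [CharZero K] (G : AddSubgroup (Fin r → ℤ))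
    (hG : G ≠ ⊤) : ∃ t : Fin r → Kˣ, t ≠ 1 ∧ ∀ m ∈ G, torusCharacter m t = 1 := by
  -- Enlarge the subgroup to a maximal one. The quotient is a simple ℤ-module ℤ/p, and it embeds
  -- into Kˣ through a primitive root of unity; the values of the resulting homomorphism on the
  -- standard basis are the coordinates of `t`.
  obtain ⟨N, hN, hGN⟩ := (eq_top_or_exists_le_coatom (AddSubgroup.toIntSubmodule G)).resolve_left
    (by simpa using hG)
  obtain ⟨I, hI, ⟨e⟩⟩ := isSimpleModule_iff_quot_maximal.mp (isSimpleModule_iff_isCoatom.mpr hN)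
  obtain ⟨p, rfl⟩ := (IsPrincipalIdealRing.principal I).principal
  have hp : p.natAbs ≠ 0 := by
    intro h
    rw [Int.natAbs_eq_zero] at h
    subst h
    refine Int.not_isField ?_
    rw [Ideal.submodule_span_eq, Ideal.span_singleton_zero] at hI
    exact Ring.isField_iff_maximal_bot.mpr hI
  have : NeZero p.natAbs := ⟨hp⟩
  obtain ⟨ζ, hζ⟩ := HasEnoughRootsOfUnity.exists_primitiveRoot K p.natAbs
  lift ζ to Kˣ using hζ.isUnit hp
  rw [IsPrimitiveRoot.coe_units_iff] at hζ
  let h : (Fin r → ℤ) →+ Additive Kˣ :=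
    ((MonoidHom.toAdditive (Subgroup.zpowers ζ).subtype).comp hζ.zmodEquivZPowers.toAddMonoidHom).comp
    ((Int.quotientSpanEquivZMod p).toAddEquiv.toAddMonoidHom.comp
      (e.toAddEquiv.toAddMonoidHom.comp N.mkQ.toAddMonoidHom))
  have hker : ∀ m, h m = 0 ↔ m ∈ N := by
    intro m
    change Additive.ofMul (((hζ.zmodEquivZPowers
      (Int.quotientSpanEquivZMod p (e (N.mkQ m)))).toMul : Subgroup.zpowers ζ) : Kˣ) = 0 ↔ _
    rw [ofMul_eq_zero, OneMemClass.coe_eq_one, toMul_eq_one, EmbeddingLike.map_eq_zero_iff,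
      EmbeddingLike.map_eq_zero_iff, EmbeddingLike.map_eq_zero_iff, Submodule.mkQ_apply,
      Submodule.Quotient.mk_eq_zero]
  refine ⟨fun i => (h (Pi.single i 1)).toMul, ?_, ?_⟩
  · intro h1
    refine hN.1 (eq_top_iff.mpr fun m _ => (hker m).mp ?_)
    apply Additive.toMul.injective
    rw [← torusCharacter_eq_of_hom, h1, torusCharacter_one]
    rfl
  · intro m hm
    rw [torusCharacter_eq_of_hom, (hker m).mpr (hGN hm)]
    rfl

end TorusCharacter

/-! ### Weight decomposition and the characters as rational functions. -/

namespace TorusAction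

variable {K : Type*} [Field K] {r : ℕ} {A : Type*} [CommRing A] [Algebra K A]
variable (T : TorusAction K r A)

section Weights

variable {T}

theorem IsWeightVector.add {m : Fin r → ℤ} {a b : A} (ha : T.IsWeightVector m a)
    (hb : T.IsWeightVector m b) : T.IsWeightVector m (a + b) := fun t => by
  rw [map_add, ha t, hb t, smul_add]

theorem IsWeightVector.smul {m : Fin r → ℤ} {a : A} (c : K) (ha : T.IsWeightVector m a) :
    T.IsWeightVector m (c • a) := fun t => by
  rw [map_smul, ha t, smul_comm]

theorem IsWeightVector.mul {m n : Fin r → ℤ} {a b : A} (ha : T.IsWeightVector m a)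
    (hb : T.IsWeightVector n b) : T.IsWeightVector (m + n) (a * b) := fun t => by
  rw [map_mul, ha t, hb t, torusCharacter_add, Units.val_mul, smul_mul_smul_comm]

theorem isWeightVector_one : T.IsWeightVector 0 1 := fun t => by simp

theorem act_sum {F : Finset (Fin r → ℤ)} {b : (Fin r → ℤ) → A}
    (hb : ∀ m ∈ F, T.IsWeightVector m (b m)) (t : Fin r → Kˣ) :
    T.act t (∑ m ∈ F, b m) = ∑ m ∈ F, (torusCharacter m t : K) • b m := by
  rw [map_sum]
  exact Finset.sum_congr rfl fun m hm => hb m hm t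

variable [CharZero K]

variable (T) in
-- The coefficients in the regularity expansion are themselves weight vectors: expand the action of
-- `s * t` on `a` in two ways and compare coefficients of characters of `t`. Evaluating at `t = 1`
-- recovers `a`.
theorem exists_weight_decomposition (a : A) : ∃ (F : Finset (Fin r → ℤ)) (b : (Fin r → ℤ) → A),
    (∀ m, T.IsWeightVector m (b m)) ∧ a = ∑ m ∈ F, b m := by
  obtain ⟨p, hp⟩ := T.regular a
  refine ⟨p.support, p, fun m => ?_, by simpa [Finsupp.sum] using hp 1⟩
  by_cases hm : m ∈ p.support
  swap
  · rw [Finsupp.notMem_support_iff.mp hm]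
    exact fun t => by simp
  intro s
  rw [← sub_eq_zero]
  refine eq_zero_of_sum_torusCharacter_smul_eq_zero (K := K) p.support
    (fun m => T.act s (p m) - (torusCharacter m s : K) • p m) (fun t => ?_) m hm
  have h1 : T.act (s * t) a = T.act s (T.act t a) := by rw [map_mul]; rfl
  rw [hp, hp, Finsupp.sum, Finsupp.sum, map_sum] at h1
  simp only [smul_sub, Finset.sum_sub_distrib, smul_smul]
  rw [sub_eq_zero]
  simp only [map_smul, torusCharacter_mul, Units.val_mul] at h1
  rw [← h1]
  exact Finset.sum_congr rfl fun m _ => by rw [mul_comm]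

/-- A stable subspace contains the weight components of its elements. -/
theorem mem_of_sum_mem {V : Submodule K A} (hV : ∀ t, ∀ a ∈ V, T.act t a ∈ V)
    {F : Finset (Fin r → ℤ)} {b : (Fin r → ℤ) → A} (hb : ∀ m ∈ F, T.IsWeightVector m (b m))
    (h : ∑ m ∈ F, b m ∈ V) : ∀ m ∈ F, b m ∈ V := by
  intro m hm
  rw [← Submodule.Quotient.mk_eq_zero]
  refine eq_zero_of_sum_torusCharacter_smul_eq_zero (K := K) F
    (fun m => V.mkQ (b m)) (fun t => ?_) m hm
  have := hV t _ h
  rw [act_sum hb, ← Submodule.Quotient.mk_eq_zero, ← Submodule.mkQ_apply, map_sum] at this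
  simpa using this

theorem eq_zero_of_sum_eq_zero {F : Finset (Fin r → ℤ)} {b : (Fin r → ℤ) → A}
    (hb : ∀ m ∈ F, T.IsWeightVector m (b m)) (h : ∑ m ∈ F, b m = 0) : ∀ m ∈ F, b m = 0 := by
  simpa using mem_of_sum_mem (V := ⊥) (fun t a ha => by simp_all) hb (by simpa using h)

end Weights

variable [IsAlgClosed K] [CharZero K] [IsDomain A] [Algebra.FiniteType K A]

/-- Evaluation at a point of the open orbit is injective on the weight spaces. -/
theorem exists_eval_ne_zero (hT : T.LocallyTransitive) :
    ∃ ev : A →ₐ[K] K, ∀ m a, T.IsWeightVector m a → ev a = 0 → a = 0 := by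
  obtain ⟨x, hx⟩ := hT
  have hxm := x.isMaximal
  let _ := Ideal.Quotient.field x.asIdeal
  have hfin : Module.Finite K (A ⧸ x.asIdeal) := finite_of_finite_type_of_isJacobsonRing _ _
  have hbij : Function.Bijective (algebraMap K (A ⧸ x.asIdeal)) :=
    IsAlgClosed.algebraMap_bijective_of_isIntegral
  let e : K ≃ₐ[K] A ⧸ x.asIdeal := AlgEquiv.ofBijective (Algebra.ofId K _) hbij
  refine ⟨e.symm.toAlgHom.comp (Ideal.Quotient.mkₐ K x.asIdeal), fun m a ha h0 => ?_⟩
  have hax : a ∈ x.asIdeal := by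
    rw [← Ideal.Quotient.eq_zero_iff_mem]
    simpa using h0
  obtain ⟨U, hU, hUx⟩ := isOpen_induced_iff.mp hx
  have hxU : x.toPrimeSpectrum ∈ U := by
    have : x ∈ T.orbit x := ⟨1, by simp; rfl⟩
    rw [← hUx] at this
    exact this
  obtain ⟨_, ⟨f, rfl⟩, hxf, hfU⟩ :=
    PrimeSpectrum.isTopologicalBasis_basic_opens.exists_subset_of_mem_open hxU hU
  have hJ : IsJacobsonRing A := isJacobsonRing_of_finiteType (A := K)
  -- A weight vector vanishing at `x` vanishes along its orbit, which contains the basic open set of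
  -- `f`. So `f * a` lies in every maximal ideal, and `A` is a Jacobson domain.
  have hfa : f * a = 0 := by
    have hbot : (⊥ : Ideal A).jacobson = ⊥ := hJ.out' _ (Ideal.isPrime_bot.isRadical)
    rw [← Ideal.mem_bot, ← hbot, Ideal.jacobson, Ideal.mem_sInf]
    rintro J ⟨-, hJm⟩
    by_cases hfJ : f ∈ J
    · exact J.mul_mem_right _ hfJ
    refine J.mul_mem_left _ ?_
    have : (⟨J, hJm⟩ : MaximalSpectrum A) ∈ T.orbit x := by
      rw [← hUx]
      exact hfU hfJ
    obtain ⟨t, ht⟩ := this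
    change J = _ at ht
    rw [ht, Ideal.mem_comap]
    change T.act t a ∈ _
    rw [ha t, Algebra.smul_def]
    exact Ideal.mul_mem_left _ _ hax
  have hf0 : f ≠ 0 := by
    rintro rfl
    exact hxf (Ideal.zero_mem _)
  exact (mul_eq_zero.mp hfa).resolve_left hf0

/-- The weights of an effective torus action generate the character lattice. -/
theorem exists_weights_sub (hTeff : T.Effective) (m : Fin r → ℤ) :
    ∃ (k l : Fin r → ℤ) (a b : A), m = k - l ∧ a ≠ 0 ∧ T.IsWeightVector k a ∧ b ≠ 0 ∧
      T.IsWeightVector l b := by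
  have htop : AddSubgroup.closure {m | ∃ a : A, a ≠ 0 ∧ T.IsWeightVector m a} = ⊤ := by
    by_contra h
    obtain ⟨t, ht1, ht⟩ := exists_torusCharacter_eq_one (K := K) _ h
    refine ht1 (hTeff ?_)
    rw [map_one]
    ext a
    obtain ⟨F, b, hb, rfl⟩ := T.exists_weight_decomposition a
    rw [act_sum fun m _ => hb m, AlgEquiv.one_apply]
    refine Finset.sum_congr rfl fun m _ => ?_
    by_cases hbm : b m = 0
    · simp [hbm]
    rw [ht m (AddSubgroup.subset_closure ⟨b m, hbm, hb m⟩), Units.val_one, one_smul]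
  have hm : m ∈ AddSubgroup.closure {m | ∃ a : A, a ≠ 0 ∧ T.IsWeightVector m a} := htop ▸ trivial
  induction hm using AddSubgroup.closure_induction with
  | mem m h =>
    obtain ⟨a, ha, ham⟩ := h
    exact ⟨m, 0, a, 1, by simp, ha, ham, one_ne_zero, isWeightVector_one⟩
  | zero => exact ⟨0, 0, 1, 1, by simp, one_ne_zero, isWeightVector_one, one_ne_zero,
      isWeightVector_one⟩
  | add m n _ _ ihm ihn =>
    obtain ⟨k, l, a, b, rfl, ha, hak, hb, hbl⟩ := ihm
    obtain ⟨k', l', a', b', rfl, ha', hak', hb', hbl'⟩ := ihn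
    exact ⟨k + k', l + l', a * a', b * b', by abel, mul_ne_zero ha ha', hak.mul hak',
      mul_ne_zero hb hb', hbl.mul hbl'⟩
  | neg m _ ih =>
    obtain ⟨k, l, a, b, rfl, ha, hak, hb, hbl⟩ := ih
    exact ⟨l, k, b, a, by abel, hb, hbl, ha, hak⟩

/-- A multiplicative choice of rational functions `χᵐ` spanning the weight spaces: the
identification of the open orbit with the torus. -/
structure CharacterSystem (T : TorusAction K r A) where
  /-- The rational function attached to a character. -/
  χ : (Fin r → ℤ) → FractionRing A
  ne_zero : ∀ m, χ m ≠ 0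
  add : ∀ m n, χ (m + n) = χ m * χ n
  isWeightVector : ∀ m a, algebraMap A (FractionRing A) a = χ m → T.IsWeightVector m a
  eq_smul : ∀ m a, T.IsWeightVector m a → ∃ c : K, algebraMap A (FractionRing A) a = c • χ m
  eq_sub : ∀ m, ∃ k l, ∃ a b : A, m = k - l ∧ algebraMap A (FractionRing A) a = χ k ∧
    algebraMap A (FractionRing A) b = χ l

/-- Each weight space contains at most one vector with value 1 at the base point. Taking χᵐ to be a
quotient of two such normalised vectors whose weights differ by m, this uniqueness makes χᵐ
independent of the choice and multiplicative in m. -/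
theorem nonempty_characterSystem (hT : T.LocallyTransitive) (hTeff : T.Effective) :
    Nonempty T.CharacterSystem := by
  obtain ⟨ev, hev⟩ := T.exists_eval_ne_zero hT
  have h1 : ∀ m (a b : A), T.IsWeightVector m a → T.IsWeightVector m b → ev a = ev b → a = b := by
    intro m a b ha hb hab
    rw [← sub_eq_zero]
    refine hev m _ ?_ (by rw [map_sub, hab, sub_self])
    simpa [sub_eq_add_neg] using ha.add (hb.smul (-1 : K))
  have h2 : ∀ m : Fin r → ℤ, ∃ (k l : Fin r → ℤ) (a b : A), m = k - l ∧ ev a = 1 ∧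
      T.IsWeightVector k a ∧ ev b = 1 ∧ T.IsWeightVector l b := by
    intro m
    obtain ⟨k, l, a, b, h, ha, hak, hb, hbl⟩ := T.exists_weights_sub hTeff m
    have ha' : ev a ≠ 0 := fun h => ha (hev _ _ hak h)
    have hb' : ev b ≠ 0 := fun h => hb (hev _ _ hbl h)
    exact ⟨k, l, (ev a)⁻¹ • a, (ev b)⁻¹ • b, h, by simp [ha'], hak.smul _, by simp [hb'],
      hbl.smul _⟩
  choose k l a b hm ha hak hb hbl using h2
  have hne : ∀ c : A, ev c = 1 → algebraMap A (FractionRing A) c ≠ 0 := by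
    rintro c hc h
    rw [FaithfulSMul.algebraMap_eq_zero_iff] at h
    simp [h] at hc
  have key : ∀ m c, T.IsWeightVector m c → ev c = 1 → algebraMap A (FractionRing A) c =
      algebraMap A (FractionRing A) (a m) / algebraMap A (FractionRing A) (b m) := by
    intro m c hc hc1
    rw [eq_div_iff (hne _ (hb m)), ← map_mul]
    congr 1
    refine h1 (k m) _ _ ?_ (hak m) (by simp [ha, hb, hc1])
    have := hc.mul (hbl m)
    rwa [show m + l m = k m by nth_rewrite 1 [hm m]; abel] at this
  refine ⟨⟨fun m => algebraMap A (FractionRing A) (a m) / algebraMap A (FractionRing A) (b m),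
    fun m => div_ne_zero (hne _ (ha m)) (hne _ (hb m)), fun m n => ?_, fun m c hc => ?_,
    fun m c hc => ?_, fun m => ?_⟩⟩
  · rw [div_mul_div_comm, div_eq_div_iff (hne _ (hb _)) (mul_ne_zero (hne _ (hb m)) (hne _ (hb n))),
      ← map_mul, ← map_mul, ← map_mul, ← map_mul]
    congr 1
    refine h1 (k (m + n) + (l m + l n)) _ _ ((hak _).mul ((hbl _).mul (hbl _))) ?_
      (by simp [ha, hb])
    have := ((hak m).mul (hak n)).mul (hbl (m + n))
    rwa [show k m + k n + l (m + n) = k (m + n) + (l m + l n) by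
      have e1 := hm m
      have e2 := hm n
      have e3 := hm (m + n)
      have e4 : k (m + n) - l (m + n) = k m - l m + (k n - l n) := by rw [← e1, ← e2, ← e3]
      rw [sub_eq_iff_eq_add] at e4
      rw [e4]
      abel] at this
  · rw [eq_div_iff (hne _ (hb m)), ← map_mul] at hc
    have hc' : c * b m = a m := FaithfulSMul.algebraMap_injective A (FractionRing A) hc
    intro t
    have h3 := hak m t
    rw [← hc', map_mul, hbl m t, show k m = m + l m by nth_rewrite 2 [hm m]; abel,
      torusCharacter_add, Units.val_mul, mul_smul_comm, mul_comm (torusCharacter m t : K),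
      mul_smul, (Units.isUnit (torusCharacter (l m) t)).smul_left_cancel, ← smul_mul_assoc] at h3
    refine mul_right_cancel₀ ?_ h3
    intro h0
    have := hb m
    simp [h0] at this
  · by_cases h0 : ev c = 0
    · exact ⟨0, by simp [hev m c hc h0]⟩
    refine ⟨ev c, ?_⟩
    rw [← key m _ (hc.smul (ev c)⁻¹) (by simp [h0]), Algebra.smul_def (ev c)⁻¹ c, map_mul,
      ← IsScalarTower.algebraMap_apply, ← Algebra.smul_def, smul_smul, mul_inv_cancel₀ h0, one_smul]
  · exact ⟨k m, l m, a m, b m, hm m, key _ _ (hak m) (ha m), key _ _ (hbl m) (hb m)⟩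

end TorusAction

/-- The quotient has no zeros or poles, so by Hartogs it and its inverse are regular; it is then a
unit, hence a constant. -/
theorem PrimeDivisor.eq_smul_of_ord_eq {K : Type*} [Field K] {A : Type*} [CommRing A] [IsDomain A]
    [Algebra K A] [IsNoetherianRing A] [IsIntegrallyClosed A]
    (hunits : ∀ u : A, IsUnit u → ∃ c : K, algebraMap K A c = u)
    {f g : FractionRing A} (hf : f ≠ 0) (hg : g ≠ 0)
    (h : ∀ P : PrimeDivisor A, P.ord f = P.ord g) : ∃ c : K, c ≠ 0 ∧ f = c • g := by
  obtain ⟨u, hu, huf⟩ := exists_algebraMap_eq_of_ord_eq_zero (div_ne_zero hf hg) fun P => by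
    rw [P.ord_div hf hg, h, sub_self]
  obtain ⟨c, rfl⟩ := hunits u hu
  refine ⟨c, ?_, ?_⟩
  · rintro rfl
    simp at hu
  · rw [Algebra.smul_def, IsScalarTower.algebraMap_apply K A, huf, div_mul_cancel₀ _ hg]

theorem TorusAction.Invariant.act_mem {K : Type*} [Field K] {r : ℕ} {A : Type*} [CommRing A]
    [Algebra K A] {T : TorusAction K r A} {P : PrimeDivisor A} (hP : T.Invariant P)
    (t : Fin r → Kˣ) (a : A) (ha : a ∈ P.asIdeal) : T.act t a ∈ P.asIdeal := by
  rw [← hP t] at ha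
  exact ha

/-! ### Expansions in characters and their orders along prime divisors. -/

namespace TorusAction.CharacterSystem

variable {K : Type*} [Field K] {r : ℕ} {A : Type*} [CommRing A] [IsDomain A] [Algebra K A]
variable {T : TorusAction K r A} (X : T.CharacterSystem)

local notation "ι" => algebraMap A (FractionRing A)

theorem χ_zero : X.χ 0 = 1 := by
  have h := X.add 0 0
  rw [add_zero] at h
  exact (mul_eq_left₀ (X.ne_zero 0)).mp h.symm

theorem χ_neg (m : Fin r → ℤ) : X.χ (-m) = (X.χ m)⁻¹ := by
  refine eq_inv_of_mul_eq_one_left ?_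
  rw [← X.add, neg_add_cancel, X.χ_zero]

theorem χ_nsmul (n : ℕ) (m : Fin r → ℤ) : X.χ (n • m) = X.χ m ^ n := by
  induction n with
  | zero => simp [X.χ_zero]
  | succ n ih => rw [succ_nsmul, X.add, ih, pow_succ]

/-- The weights of regular functions. -/
def regular : AddSubmonoid (Fin r → ℤ) where
  carrier := {m | ∃ a : A, ι a = X.χ m}
  zero_mem' := ⟨1, by rw [X.χ_zero, map_one]⟩
  add_mem' := by
    rintro m n ⟨a, ha⟩ ⟨b, hb⟩
    exact ⟨a * b, by rw [map_mul, ha, hb, X.add]⟩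

theorem ne_zero_of_eq {a : A} {m : Fin r → ℤ} (h : ι a = X.χ m) : a ≠ 0 := by
  rintro rfl
  exact X.ne_zero m (by rw [← h, map_zero])

theorem mem_regular_of_isWeightVector {m : Fin r → ℤ} {a : A} (ha0 : a ≠ 0)
    (ha : T.IsWeightVector m a) : m ∈ X.regular := by
  obtain ⟨c, hc⟩ := X.eq_smul m a ha
  have hc0 : c ≠ 0 := by
    rintro rfl
    rw [zero_smul, FaithfulSMul.algebraMap_eq_zero_iff] at hc
    exact ha0 hc
  refine ⟨c⁻¹ • a, ?_⟩
  rw [Algebra.smul_def c⁻¹ a, map_mul, ← IsScalarTower.algebraMap_apply, ← Algebra.smul_def, hc,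
    smul_smul, inv_mul_cancel₀ hc0, one_smul]

/-- A common denominator for finitely many characters, itself a regular character. -/
theorem exists_shift (F : Finset (Fin r → ℤ)) :
    ∃ s ∈ X.regular, ∀ m ∈ F, m + s ∈ X.regular := by
  induction F using Finset.cons_induction with
  | empty => exact ⟨0, zero_mem _, by simp⟩
  | cons m F hm ih =>
    obtain ⟨s, hs, hF⟩ := ih
    obtain ⟨k, l, a, b, rfl, ha, hb⟩ := X.eq_sub m
    refine ⟨s + l, add_mem hs ⟨b, hb⟩, fun n hn => ?_⟩
    obtain rfl | hn := Finset.mem_cons.mp hn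
    · rw [show k - l + (s + l) = k + s by abel]
      exact add_mem ⟨a, ha⟩ hs
    · rw [← add_assoc]
      exact add_mem (hF n hn) ⟨b, hb⟩

variable [CharZero K]

theorem exists_expansion (a : A) : ∃ (F : Finset (Fin r → ℤ)) (c : (Fin r → ℤ) → K),
    (∀ m ∈ F, c m ≠ 0) ∧ (∀ m ∈ F, m ∈ X.regular) ∧ ι a = ∑ m ∈ F, c m • X.χ m := by
  classical
  obtain ⟨F, b, hb, rfl⟩ := T.exists_weight_decomposition a
  choose c hc using fun m => X.eq_smul m (b m) (hb m)
  refine ⟨F.filter fun m => c m ≠ 0, c, by simp, fun m hm => ?_, ?_⟩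
  · refine X.mem_regular_of_isWeightVector ?_ (hb m)
    intro h
    have := hc m
    rw [h, map_zero, eq_comm, smul_eq_zero] at this
    exact this.elim (Finset.mem_filter.mp hm).2 (X.ne_zero m)
  · rw [map_sum, Finset.sum_filter]
    refine Finset.sum_congr rfl fun m _ => ?_
    rw [hc]
    split_ifs with h
    · rfl
    · rw [not_not.mp h, zero_smul]

/-- Multiplying by a common denominator moves a relation into `A`, where weight vectors of distinct
weights are independent. -/
theorem linearIndependent : LinearIndependent K X.χ := by
  rw [linearIndependent_iff']
  intro F g hg m hm
  obtain ⟨s, hs, hF⟩ := X.exists_shift F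
  choose a ha using hF
  let b : (Fin r → ℤ) → A := fun n => if h : n - s ∈ F then g (n - s) • a (n - s) h else 0
  have hb : ∀ n ∈ F.map (addRightEmbedding s), T.IsWeightVector n (b n) := by
    intro n hn
    obtain ⟨k, hk, rfl⟩ := Finset.mem_map.mp hn
    have hb' : b (addRightEmbedding s k) = g k • a k hk := by simp [b, hk]
    rw [hb']
    exact (X.isWeightVector _ _ (ha k hk)).smul _
  have h0 : ∑ n ∈ F.map (addRightEmbedding s), b n = 0 := by
    apply FaithfulSMul.algebraMap_injective A (FractionRing A)
    rw [Finset.sum_map, map_sum, map_zero]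
    have : ∑ k ∈ F, ι (b (addRightEmbedding s k)) = (∑ k ∈ F, g k • X.χ k) * X.χ s := by
      rw [Finset.sum_mul]
      refine Finset.sum_congr rfl fun k hk => ?_
      have hb' : b (addRightEmbedding s k) = g k • a k hk := by simp [b, hk]
      rw [hb', Algebra.smul_def (g k) (a k hk), map_mul, ← IsScalarTower.algebraMap_apply,
        ← Algebra.smul_def, ha, X.add, smul_mul_assoc]
    rw [this, hg, zero_mul]
  have h1 := eq_zero_of_sum_eq_zero hb h0 (m + s) (Finset.mem_map_of_mem _ hm)
  have hb' : b (m + s) = g m • a m hm := by simp [b, hm]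
  rw [hb', smul_eq_zero] at h1
  exact h1.resolve_right (X.ne_zero_of_eq (ha m hm))

theorem mem_of_stable {V : Submodule K A} (hV : ∀ t, ∀ a ∈ V, T.act t a ∈ V) {a : A} (ha : a ∈ V)
    {F : Finset (Fin r → ℤ)} {c : (Fin r → ℤ) → K} (hc : ∀ m ∈ F, c m ≠ 0)
    (hF : ∀ m ∈ F, m ∈ X.regular) (h : ι a = ∑ m ∈ F, c m • X.χ m) {m : Fin r → ℤ} (hm : m ∈ F)
    {e : A} (he : ι e = X.χ m) : e ∈ V := by
  have hF' : ∀ m, ∃ a : A, m ∈ F → ι a = X.χ m := fun m => by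
    by_cases hm : m ∈ F
    · obtain ⟨a, ha⟩ := hF m hm
      exact ⟨a, fun _ => ha⟩
    · exact ⟨0, fun h => (hm h).elim⟩
  choose b hb using hF'
  have hsum : a = ∑ m ∈ F, c m • b m := by
    apply FaithfulSMul.algebraMap_injective A (FractionRing A)
    rw [h, map_sum]
    refine Finset.sum_congr rfl fun k hk => ?_
    rw [Algebra.smul_def (c k) (b k), map_mul, ← IsScalarTower.algebraMap_apply,
        ← Algebra.smul_def, hb k hk]
  rw [hsum] at ha
  have h1 := mem_of_sum_mem hV (b := fun m => c m • b m)
    (fun m hm => (X.isWeightVector m _ (hb m hm)).smul _) ha m hm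
  rw [V.smul_mem_iff (hc m hm)] at h1
  rwa [show e = b m from FaithfulSMul.algebraMap_injective A (FractionRing A)
    (by rw [he, hb m hm])]

/-- The weight semigroup is finitely generated. -/
theorem exists_finset_regular_le_closure [Algebra.FiniteType K A] :
    ∃ G : Finset (Fin r → ℤ), (∀ m ∈ G, m ∈ X.regular) ∧
      X.regular ≤ AddSubmonoid.closure (G : Set (Fin r → ℤ)) := by
  classical
  obtain ⟨s, hs⟩ := (Algebra.FiniteType.out : (⊤ : Subalgebra K A).FG)
  choose F c hc hF h using X.exists_expansion
  let G := s.biUnion F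
  refine ⟨G, ?_, ?_⟩
  · intro m hm
    obtain ⟨a, ha, hma⟩ := Finset.mem_biUnion.mp hm
    exact hF a m hma
  let B : Subalgebra K (FractionRing A) := Algebra.adjoin K (X.χ '' G)
  have hB : ∀ a : A, ι a ∈ B := by
    intro a
    have ha : a ∈ Algebra.adjoin K (s : Set A) := hs ▸ trivial
    induction ha using Algebra.adjoin_induction with
    | mem a ha =>
      rw [h]
      refine sum_mem fun m hm => B.smul_mem (Algebra.subset_adjoin ⟨m, ?_, rfl⟩) _
      exact Finset.mem_biUnion.mpr ⟨a, ha, hm⟩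
    | algebraMap c =>
      rw [← IsScalarTower.algebraMap_apply]
      exact B.algebraMap_mem c
    | add a b _ _ ha hb => rw [map_add]; exact add_mem ha hb
    | mul a b _ _ ha hb => rw [map_mul]; exact mul_mem ha hb
  have hle : Subalgebra.toSubmodule B ≤
      Submodule.span K (X.χ '' (AddSubmonoid.closure (G : Set (Fin r → ℤ)) : Set (Fin r → ℤ))) := by
    rw [Algebra.adjoin_eq_span]
    refine Submodule.span_mono ?_
    intro f hf
    induction hf using Submonoid.closure_induction with
    | mem f hf =>
      obtain ⟨m, hm, rfl⟩ := hf
      exact ⟨m, AddSubmonoid.subset_closure hm, rfl⟩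
    | one => exact ⟨0, zero_mem _, X.χ_zero⟩
    | mul f g _ _ hf hg =>
      obtain ⟨m, hm, rfl⟩ := hf
      obtain ⟨n, hn, rfl⟩ := hg
      exact ⟨m + n, add_mem hm hn, X.add m n⟩
  -- By construction the weights occurring in a finite set of algebra generators already span `A`;
  -- independence of the characters forces any regular weight into their monoid closure.
  rintro m ⟨a, ha⟩
  by_contra hm
  refine X.linearIndependent.notMem_span_image hm ?_
  rw [← ha]
  exact hle (hB a)

variable [IsNoetherianRing A] [IsIntegrallyClosed A]

/-- The order of vanishing of characters along a prime divisor. -/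
def val (P : PrimeDivisor A) : (Fin r → ℤ) →+ ℤ where
  toFun m := P.ord (X.χ m)
  map_zero' := by rw [X.χ_zero, P.ord_one]
  map_add' m n := by rw [X.add, P.ord_mul (X.ne_zero m) (X.ne_zero n)]

theorem val_apply (P : PrimeDivisor A) (m : Fin r → ℤ) : X.val P m = P.ord (X.χ m) := rfl

theorem val_nonneg (P : PrimeDivisor A) {m : Fin r → ℤ} (hm : m ∈ X.regular) : 0 ≤ X.val P m := by
  obtain ⟨a, ha⟩ := hm
  rw [val_apply, ← ha]
  exact P.ord_algebraMap_nonneg a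

theorem val_pos_iff (P : PrimeDivisor A) {m : Fin r → ℤ} {a : A} (ha : ι a = X.χ m) :
    0 < X.val P m ↔ a ∈ P.asIdeal := by
  rw [val_apply, ← ha]
  exact P.ord_algebraMap_pos_iff (X.ne_zero_of_eq ha)

/-- An invariant prime divisor contains the homogeneous components of its elements. -/
theorem val_pos_of_mem {P : PrimeDivisor A} (hP : T.Invariant P) {a : A} (ha : a ∈ P.asIdeal)
    {F : Finset (Fin r → ℤ)} {c : (Fin r → ℤ) → K} (hc : ∀ m ∈ F, c m ≠ 0)
    (hF : ∀ m ∈ F, m ∈ X.regular) (h : ι a = ∑ m ∈ F, c m • X.χ m) {m : Fin r → ℤ} (hm : m ∈ F) :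
    0 < X.val P m := by
  obtain ⟨e, he⟩ := hF m hm
  rw [X.val_pos_iff P he]
  exact X.mem_of_stable (V := P.asIdeal.restrictScalars K) (fun t a => hP.act_mem t a) ha hc hF h
    hm he

theorem mem_of_val_pos (P : PrimeDivisor A) {a : A}
    {F : Finset (Fin r → ℤ)} {c : (Fin r → ℤ) → K}
    (h : ι a = ∑ m ∈ F, c m • X.χ m)
    (hv : ∀ m ∈ F, 0 < X.val P m) : a ∈ P.asIdeal := by
  by_cases ha0 : a = 0
  · simp [ha0]
  have h1 : ι a ∈ P.filtration 1 := by
    rw [h]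
    refine sum_mem fun m hm => ?_
    rw [← algebraMap_smul A]
    exact (P.filtration 1).smul_mem _ ((P.mem_filtration_of_ne_zero (X.ne_zero m)).mpr (hv m hm))
  rw [P.mem_filtration_of_ne_zero (by simpa using ha0)] at h1
  exact (P.ord_algebraMap_pos_iff ha0).mp (by omega)

theorem exists_val_pos {P : PrimeDivisor A} (hP : T.Invariant P) :
    ∃ m ∈ X.regular, 0 < X.val P m := by
  obtain ⟨a, ha, ha0⟩ := Submodule.exists_mem_ne_zero_of_ne_bot P.ne_bot
  obtain ⟨F, c, hc, hF, h⟩ := X.exists_expansion a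
  obtain ⟨m, hm⟩ : F.Nonempty := by
    by_contra hne
    rw [Finset.not_nonempty_iff_eq_empty.mp hne, Finset.sum_empty,
      FaithfulSMul.algebraMap_eq_zero_iff] at h
    exact ha0 h
  exact ⟨m, hF m hm, X.val_pos_of_mem hP ha hc hF h hm⟩

section Invariant

variable [IsAlgClosed K]

/-- A prime divisor on which some character vanishes is invariant. -/
theorem invariant_of_val_pos {P : PrimeDivisor A} {m : Fin r → ℤ} (hm : m ∈ X.regular)
    (hv : 0 < X.val P m) : T.Invariant P := by
  obtain ⟨a, ha⟩ := hm
  -- The torus permutes the finite set `Y` of prime divisors containing the weight vector `a`. As K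
  -- is algebraically closed, every `t` is an N-th power for N = |Y|!, and the N-th power of a
  -- permutation of `Y` is the identity.
  let Y := {Q : PrimeDivisor A // a ∈ Q.asIdeal}
  have : Finite Y := PrimeDivisor.finite_mem (X.ne_zero_of_eq ha)
  let _ : Fintype Y := Fintype.ofFinite Y
  have haT := X.isWeightVector m a ha
  let f : (Fin r → Kˣ) → Y → Y := fun t Q =>
    ⟨⟨⟨Q.1.asIdeal.comap (T.act t : A →+* A), inferInstance⟩, by
      exact (RingEquiv.height_comap (T.act t).toRingEquiv Q.1.asIdeal).trans Q.1.height_eq⟩, by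
      change T.act t a ∈ Q.1.asIdeal
      rw [haT t, Algebra.smul_def]
      exact Ideal.mul_mem_left _ _ Q.2⟩
  have hmem : ∀ t Q b, b ∈ (f t Q).1.asIdeal ↔ T.act t b ∈ Q.1.asIdeal := fun _ _ _ => Iff.rfl
  have hfmul : ∀ s t Q, f (s * t) Q = f t (f s Q) := by
    intro s t Q
    refine Subtype.ext (PrimeDivisor.asIdeal_injective (Ideal.ext fun b => ?_))
    simp only [hmem, map_mul]
    rfl
  have hfone : ∀ Q, f 1 Q = Q := by
    intro Q
    refine Subtype.ext (PrimeDivisor.asIdeal_injective (Ideal.ext fun b => ?_))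
    simp only [hmem, map_one]
    rfl
  have hfpow : ∀ t n, f (t ^ n) = (f t)^[n] := by
    intro t n
    induction n with
    | zero => funext Q; simp [hfone]
    | succ n ih =>
      funext Q
      rw [pow_succ, hfmul, ih, Function.iterate_succ_apply']
  intro t
  let N := (Fintype.card Y).factorial
  choose u hu using fun i => IsAlgClosed.exists_pow_nat_eq (t i : K)
    (Nat.factorial_pos (Fintype.card Y))
  have hu0 : ∀ i, u i ≠ 0 := fun i h0 => (t i).ne_zero (by
    rw [← hu i, h0, zero_pow (Nat.factorial_ne_zero _)])
  have htu : t = (fun i => Units.mk0 (u i) (hu0 i)) ^ N := by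
    funext i
    ext
    simp [N, hu]
  have hinj : Function.Injective (f fun i => Units.mk0 (u i) (hu0 i)) := by
    refine Function.LeftInverse.injective (g := f (fun i => Units.mk0 (u i) (hu0 i))⁻¹) fun Q => ?_
    rw [← hfmul, mul_inv_cancel, hfone]
  have hper := Function.isPeriodicPt_factorial_card_of_mem_periodicPts
    (hinj.mem_periodicPts ⟨P, (X.val_pos_iff P ha).mp hv⟩)
  have := congrArg (fun Q : Y => Q.1.asIdeal) hper
  simp only [← hfpow] at this
  rwa [← htu] at this

/-- A regular character vanishing along P would make P invariant, and every character is a quotient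
of regular ones. -/
theorem val_eq_zero {P : PrimeDivisor A} (hP : ¬ T.Invariant P) (m : Fin r → ℤ) :
    X.val P m = 0 := by
  have h : ∀ m ∈ X.regular, X.val P m = 0 := fun m hm =>
    le_antisymm (not_lt.mp fun h => hP (X.invariant_of_val_pos hm h)) (X.val_nonneg P hm)
  obtain ⟨k, l, a, b, rfl, ha, hb⟩ := X.eq_sub m
  rw [map_sub, h k ⟨a, ha⟩, h l ⟨b, hb⟩, sub_zero]

theorem mem_regular_iff {m : Fin r → ℤ} :
    m ∈ X.regular ↔ ∀ P : PrimeDivisor A, T.Invariant P → 0 ≤ X.val P m := by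
  refine ⟨fun hm P _ => X.val_nonneg P hm, fun h =>
    PrimeDivisor.mem_range_of_ord_nonneg fun P => ?_⟩
  by_cases hP : T.Invariant P
  · exact h P hP
  · exact (X.val_eq_zero hP m).ge

/-- An invariant prime contains some regular character, hence one from a finite generating set of
the weight semigroup; each nonzero function lies in only finitely many prime divisors. -/
theorem finite_invariant [Algebra.FiniteType K A] (X : T.CharacterSystem) :
    Finite {P : PrimeDivisor A // T.Invariant P} := by
  obtain ⟨G, hG, hle⟩ := X.exists_finset_regular_le_closure
  choose e he using hG
  refine Set.Finite.subset (s := ⋃ g : G, {P : PrimeDivisor A | e g.1 g.2 ∈ P.asIdeal})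
    (Set.finite_iUnion fun g => PrimeDivisor.finite_mem (X.ne_zero_of_eq (he g.1 g.2)))
    fun P hP => ?_
  obtain ⟨m, hm, hv⟩ := X.exists_val_pos hP
  by_contra hcon
  simp only [Set.mem_iUnion, Set.mem_ofPred_eq, ← X.val_pos_iff P (he _ _), not_exists,
    not_lt] at hcon
  have : ∀ m ∈ AddSubmonoid.closure (G : Set (Fin r → ℤ)), X.val P m ≤ 0 := by
    intro m hm
    induction hm using AddSubmonoid.closure_induction with
    | mem m hm => exact hcon ⟨m, hm⟩
    | zero => simp
    | add m n _ _ h1 h2 => rw [map_add]; omega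
  exact hv.not_ge (this m (hle hm))

/-- If every regular character in Q were in P, expanding elements of the invariant prime Q in
characters would give Q ⊆ P, impossible between distinct primes of height one. -/
theorem exists_val_pos_of_ne {P Q : PrimeDivisor A} (hQ : T.Invariant Q) (h : Q ≠ P) :
    ∃ m ∈ X.regular, X.val P m = 0 ∧ 0 < X.val Q m := by
  by_contra! hcon
  refine h (PrimeDivisor.eq_of_le fun a ha => ?_)
  obtain ⟨F, c, hc, hF, hs⟩ := X.exists_expansion a
  refine X.mem_of_val_pos P hs fun m hm => lt_of_le_of_ne (X.val_nonneg P (hF m hm)) fun h0 => ?_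
  exact (hcon m (hF m hm) h0.symm).not_gt (X.val_pos_of_mem hQ ha hc hF hs hm)

variable [Algebra.FiniteType K A]

/-- Sum over Q of the separating weights for the pairs (P, Q). The result is the supporting
functional that exhibits the ray of P as a face of σ. -/
theorem exists_val_eq_zero_iff (P : {P : PrimeDivisor A // T.Invariant P}) :
    ∃ m ∈ X.regular, X.val P.1 m = 0 ∧ ∀ Q : PrimeDivisor A, T.Invariant Q → Q ≠ P.1 →
      0 < X.val Q m := by
  classical
  have := X.finite_invariant
  let _ := Fintype.ofFinite {P : PrimeDivisor A // T.Invariant P}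
  have h : ∀ Q : {P : PrimeDivisor A // T.Invariant P}, ∃ m ∈ X.regular, X.val P.1 m = 0 ∧
      (Q ≠ P → 0 < X.val Q.1 m) := by
    intro Q
    by_cases hQ : Q = P
    · exact ⟨0, zero_mem _, map_zero _, fun h => (h hQ).elim⟩
    · obtain ⟨m, hm, h1, h2⟩ := X.exists_val_pos_of_ne Q.2 (fun h => hQ (Subtype.ext h))
      exact ⟨m, hm, h1, fun _ => h2⟩
  choose m hm h1 h2 using h
  refine ⟨∑ Q, m Q, sum_mem fun Q _ => hm Q, ?_, fun Q hQ hQP => ?_⟩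
  · rw [map_sum]
    exact Finset.sum_eq_zero fun Q _ => h1 Q
  · rw [map_sum]
    exact Finset.sum_pos' (fun Q' _ => X.val_nonneg _ (hm Q'))
      ⟨⟨Q, hQ⟩, Finset.mem_univ _, h2 ⟨Q, hQ⟩ fun h => hQP (congrArg Subtype.val h)⟩

theorem exists_forall_val_pos :
    ∃ m ∈ X.regular, ∀ Q : PrimeDivisor A, T.Invariant Q → 0 < X.val Q m := by
  have := X.finite_invariant
  let _ := Fintype.ofFinite {P : PrimeDivisor A // T.Invariant P}
  choose m hm h using fun P : {P : PrimeDivisor A // T.Invariant P} => X.exists_val_pos P.2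
  refine ⟨∑ Q, m Q, sum_mem fun Q _ => hm Q, fun Q hQ => ?_⟩
  rw [map_sum]
  exact Finset.sum_pos' (fun Q' _ => X.val_nonneg _ (hm Q')) ⟨⟨Q, hQ⟩, Finset.mem_univ _, h ⟨Q, hQ⟩⟩

/-- The functions of order at least n along an invariant P form a torus-stable subspace, so no term
of an expansion has smaller order than the whole: nothing cancels. -/
theorem ord_le_val {P : PrimeDivisor A} (hP : T.Invariant P) {a : A} (ha0 : a ≠ 0)
    {F : Finset (Fin r → ℤ)} {c : (Fin r → ℤ) → K} (hc : ∀ m ∈ F, c m ≠ 0)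
    (hF : ∀ m ∈ F, m ∈ X.regular) (h : ι a = ∑ m ∈ F, c m • X.χ m) {m : Fin r → ℤ} (hm : m ∈ F) :
    P.ord (ι a) ≤ X.val P m := by
  obtain ⟨e, he⟩ := hF m hm
  obtain ⟨n, hn⟩ := Int.eq_ofNat_of_zero_le (P.ord_algebraMap_nonneg a)
  have hι : ι a ≠ 0 := by simpa using ha0
  have h1 := X.mem_of_stable (V := ((P.filtration n).comap (Algebra.linearMap A _)).restrictScalars
    K)
    (fun t a ha => P.algebraMap_mem_filtration (T.act t).toRingEquiv (hP t) ha)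
    (a := a) ((P.mem_filtration_of_ne_zero hι).mpr hn.ge) hc hF h hm he
  rw [hn]
  change ι e ∈ P.filtration n at h1
  rwa [he, P.mem_filtration_of_ne_zero (X.ne_zero m)] at h1

/-- Rational functions without poles on the open orbit are combinations of characters. -/
theorem exists_expansion_of_ord_nonneg {f : FractionRing A} (hf0 : f ≠ 0)
    (hf : ∀ P : PrimeDivisor A, ¬ T.Invariant P → 0 ≤ P.ord f) :
    ∃ (F : Finset (Fin r → ℤ)) (c : (Fin r → ℤ) → K), f = ∑ m ∈ F, c m • X.χ m ∧
      ∀ m ∈ F, ∀ P : PrimeDivisor A, T.Invariant P → P.ord f ≤ X.val P m := by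
  have := X.finite_invariant
  obtain ⟨s, hs, hspos⟩ := X.exists_forall_val_pos
  -- `N` bounds all pole orders along the finitely many invariant primes. Since χˢ vanishes along
  -- each of them, f χ^(N s) is regular by Hartogs; its expansion is then shifted back by -N s.
  obtain ⟨N, hN⟩ : ∃ N : ℕ, ∀ P : {P : PrimeDivisor A // T.Invariant P}, -P.1.ord f ≤ N := by
    obtain ⟨N, hN⟩ := (Set.finite_range fun P : {P : PrimeDivisor A // T.Invariant P} =>
      (-P.1.ord f).toNat).bddAbove
    exact ⟨N, fun P => Int.toNat_le.mp (hN ⟨P, rfl⟩)⟩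
  have hord : ∀ P : PrimeDivisor A, P.ord (f * X.χ (N • s)) = P.ord f + N * X.val P s := by
    intro P
    rw [P.ord_mul hf0 (X.ne_zero _), ← X.val_apply, map_nsmul, nsmul_eq_mul]
  obtain ⟨a, ha⟩ := PrimeDivisor.mem_range_of_ord_nonneg (f := f * X.χ (N • s)) (by
    intro P
    rw [hord]
    by_cases hP : T.Invariant P
    · have h1 := hspos P hP
      have h2 : -P.ord f ≤ N := hN ⟨P, hP⟩
      nlinarith
    · rw [X.val_eq_zero hP, mul_zero, add_zero]
      exact hf P hP)
  have ha0 : a ≠ 0 := by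
    rintro rfl
    rw [map_zero, eq_comm, mul_eq_zero] at ha
    exact ha.elim hf0 (X.ne_zero _)
  obtain ⟨F, c, hc, hF, h⟩ := X.exists_expansion a
  refine ⟨F.map (addRightEmbedding (-(N • s))), fun m => c (m + N • s), ?_, ?_⟩
  · rw [Finset.sum_map]
    simp only [addRightEmbedding_apply, neg_add_cancel_right, X.add, X.χ_neg]
    rw [← mul_left_inj' (X.ne_zero (N • s)), ← ha, h, Finset.sum_mul]
    refine Finset.sum_congr rfl fun m _ => ?_
    rw [smul_mul_assoc, mul_assoc, inv_mul_cancel₀ (X.ne_zero _), mul_one]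
  · intro m hm P hP
    obtain ⟨k, hk, rfl⟩ := Finset.mem_map.mp hm
    have h1 := X.ord_le_val hP ha0 hc hF h hk
    rw [ha, hord] at h1
    rw [addRightEmbedding_apply, map_add, map_neg, map_nsmul, nsmul_eq_mul]
    linarith

/-- A rational function with invariant divisor is a multiple of a character. -/
theorem exists_eq_smul_of_ord_eq_zero
    (hunits : ∀ u : A, IsUnit u → ∃ c : K, algebraMap K A c = u) {f : FractionRing A} (hf0 : f ≠ 0)
    (hf : ∀ P : PrimeDivisor A, ¬ T.Invariant P → P.ord f = 0) :
    ∃ (c : K) (m : Fin r → ℤ), c ≠ 0 ∧ f = c • X.χ m := by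
  obtain ⟨F, c, h, hF⟩ := X.exists_expansion_of_ord_nonneg hf0 fun P hP => (hf P hP).ge
  obtain ⟨F', c', h', hF'⟩ := X.exists_expansion_of_ord_nonneg (inv_ne_zero hf0) fun P hP => by
    rw [P.ord_inv, hf P hP, neg_zero]
  -- The product of the two expansions is χ⁰, so by independence opposite weights must occur. The
  -- order bounds for f and f⁻¹ then squeeze to equality, and f has the divisor of χᵏ.
  obtain ⟨k, hk, l, hl, hkl⟩ : ∃ k ∈ F, ∃ l ∈ F', k + l = 0 := by
    by_contra! hcon
    refine X.linearIndependent.notMem_span_image (s := {0}ᶜ) (x := 0) (by simp) ?_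
    rw [X.χ_zero, ← mul_inv_cancel₀ hf0]
    nth_rewrite 1 [h]
    rw [h', Finset.sum_mul_sum]
    refine sum_mem fun k hk => sum_mem fun l hl => ?_
    rw [smul_mul_smul_comm, ← X.add]
    exact Submodule.smul_mem _ _ (Submodule.subset_span ⟨_, hcon k hk l hl, rfl⟩)
  obtain ⟨d, hd, hfd⟩ := PrimeDivisor.eq_smul_of_ord_eq hunits hf0 (X.ne_zero k) fun P => by
    by_cases hP : T.Invariant P
    · have h1 := hF k hk P hP
      have h2 := hF' l hl P hP
      have h3 : X.val P k + X.val P l = 0 := by rw [← map_add, hkl, map_zero]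
      rw [P.ord_inv] at h2
      rw [X.val_apply] at h1 h3
      linarith
    · rw [hf P hP, ← X.val_apply, X.val_eq_zero hP]
  exact ⟨d, k, hd, hfd⟩

end Invariant

end TorusAction.CharacterSystem

/-! ### Factoriality of the open orbit: every divisor is principal off the invariant primes. -/

namespace TorusAction.CharacterSystem

variable {K : Type*} [Field K] {r : ℕ} {A : Type*} [CommRing A] [IsDomain A] [Algebra K A]
variable {T : TorusAction K r A} (X : T.CharacterSystem)

local notation "ι" => algebraMap A (FractionRing A)

/-- Polynomials in the coordinates of the torus as rational functions. -/
def ofPolynomial : MvPolynomial (Fin r) K →ₐ[K] FractionRing A :=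
  MvPolynomial.aeval fun i => X.χ (Pi.single i 1)

theorem χ_sum {κ : Type*} (F : Finset κ) (m : κ → Fin r → ℤ) :
    X.χ (∑ j ∈ F, m j) = ∏ j ∈ F, X.χ (m j) := by
  induction F using Finset.cons_induction with
  | empty => simp [X.χ_zero]
  | cons j F hj ih => rw [Finset.sum_cons, Finset.prod_cons, X.add, ih]

theorem ofPolynomial_monomial (u : Fin r →₀ ℕ) (c : K) :
    X.ofPolynomial (MvPolynomial.monomial u c) = c • X.χ fun i => (u i : ℤ) := by
  rw [ofPolynomial, MvPolynomial.aeval_monomial, Algebra.smul_def]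
  congr 1
  rw [Finsupp.prod_fintype _ _ (by simp)]
  have h : (fun i => (u i : ℤ)) = ∑ i, u i • (Pi.single i 1 : Fin r → ℤ) := by
    rw [← Finset.univ_sum_single fun i => (u i : ℤ)]
    refine Finset.sum_congr rfl fun i _ => ?_
    rw [← Pi.single_smul, nsmul_eq_mul, mul_one]
  rw [h, X.χ_sum]
  exact Finset.prod_congr rfl fun i _ => (X.χ_nsmul _ _).symm

theorem ofPolynomial_eq_sum (p : MvPolynomial (Fin r) K) :
    X.ofPolynomial p = ∑ u ∈ p.support, p.coeff u • X.χ fun i => (u i : ℤ) := by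
  conv_lhs => rw [p.as_sum, map_sum]
  exact Finset.sum_congr rfl fun u _ => X.ofPolynomial_monomial u _

/-- A Laurent polynomial becomes a polynomial after multiplication by a monomial. Monomials have
order zero along non-invariant primes, so this costs nothing there. -/
theorem exists_mul_eq_ofPolynomial {f : FractionRing A}
    (hf : f ∈ Submodule.span K (Set.range X.χ)) :
    ∃ (u : Fin r →₀ ℕ) (p : MvPolynomial (Fin r) K),
      X.ofPolynomial (MvPolynomial.monomial u 1) * f = X.ofPolynomial p := by
  induction hf using Submodule.span_induction with
  | mem f hf =>
    obtain ⟨m, rfl⟩ := hf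
    refine ⟨Finsupp.equivFunOnFinite.symm fun i => (-m i).toNat,
      MvPolynomial.monomial (Finsupp.equivFunOnFinite.symm fun i => (m i).toNat) 1, ?_⟩
    rw [ofPolynomial_monomial, ofPolynomial_monomial, one_smul, one_smul, ← X.add]
    congr 1
    funext i
    simp only [Pi.add_apply, Finsupp.equivFunOnFinite_symm_apply_apply]
    omega
  | zero => exact ⟨0, 0, by simp⟩
  | add f g _ _ hf hg =>
    obtain ⟨u, p, hp⟩ := hf
    obtain ⟨v, q, hq⟩ := hg
    refine ⟨u + v, MvPolynomial.monomial v 1 * p + MvPolynomial.monomial u 1 * q, ?_⟩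
    rw [show MvPolynomial.monomial (u + v) (1 : K) =
      MvPolynomial.monomial u 1 * MvPolynomial.monomial v 1 by simp [MvPolynomial.monomial_mul]]
    simp only [map_add, map_mul]
    rw [← hp, ← hq]
    ring
  | smul c f _ hf =>
    obtain ⟨u, p, hp⟩ := hf
    exact ⟨u, c • p, by rw [mul_smul_comm, hp, map_smul]⟩

theorem exists_mul_eq_algebraMap {f : FractionRing A}
    (hf : f ∈ Submodule.span K (Set.range X.χ)) :
    ∃ s ∈ X.regular, ∃ a : A, X.χ s * f = ι a := by
  induction hf using Submodule.span_induction with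
  | mem f hf =>
    obtain ⟨m, rfl⟩ := hf
    obtain ⟨k, l, a, b, rfl, ha, hb⟩ := X.eq_sub m
    exact ⟨l, ⟨b, hb⟩, a, by rw [← X.add, add_sub_cancel, ha]⟩
  | zero => exact ⟨0, zero_mem _, 0, by simp⟩
  | add f g _ _ hf hg =>
    obtain ⟨s, ⟨e, he⟩, a, ha⟩ := hf
    obtain ⟨t, ⟨d, hd⟩, b, hb⟩ := hg
    refine ⟨s + t, add_mem ⟨e, he⟩ ⟨d, hd⟩, d * a + e * b, ?_⟩
    rw [map_add, map_mul, map_mul, ← ha, ← hb, he, hd, X.add]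
    ring
  | smul c f _ hf =>
    obtain ⟨s, hs, a, ha⟩ := hf
    refine ⟨s, hs, c • a, ?_⟩
    rw [mul_smul_comm, ha, Algebra.smul_def c a, map_mul, ← IsScalarTower.algebraMap_apply,
      ← Algebra.smul_def]

theorem ofPolynomial_mem_span (p : MvPolynomial (Fin r) K) :
    X.ofPolynomial p ∈ Submodule.span K (Set.range X.χ) := by
  rw [X.ofPolynomial_eq_sum]
  exact sum_mem fun u _ => Submodule.smul_mem _ _ (Submodule.subset_span ⟨_, rfl⟩)

variable [CharZero K]

theorem algebraMap_mem_span (a : A) : ι a ∈ Submodule.span K (Set.range X.χ) := by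
  obtain ⟨F, c, -, -, h⟩ := X.exists_expansion a
  rw [h]
  exact sum_mem fun u _ => Submodule.smul_mem _ _ (Submodule.subset_span ⟨_, rfl⟩)

theorem ofPolynomial_injective : Function.Injective X.ofPolynomial := by
  rw [injective_iff_map_eq_zero]
  intro p hp
  rw [X.ofPolynomial_eq_sum] at hp
  have hinj : Function.Injective fun (u : Fin r →₀ ℕ) (i : Fin r) => (u i : ℤ) := by
    intro u v h
    ext i
    exact Int.ofNat_inj.mp (congrFun h i)
  have h := linearIndependent_iff'.mp (X.linearIndependent.comp _ hinj) _ _ hp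
  ext u
  rw [MvPolynomial.coeff_zero]
  by_contra hu
  exact hu (h u (MvPolynomial.mem_support_iff.mpr hu))

variable [IsNoetherianRing A] [IsIntegrallyClosed A] [IsAlgClosed K]

theorem ofPolynomial_mem_filtration {P : PrimeDivisor A} (hP : ¬ T.Invariant P)
    (p : MvPolynomial (Fin r) K) : X.ofPolynomial p ∈ P.filtration 0 := by
  rw [X.ofPolynomial_eq_sum]
  refine sum_mem fun m _ => ?_
  rw [← algebraMap_smul A]
  refine (P.filtration 0).smul_mem _ ((P.mem_filtration_of_ne_zero (X.ne_zero _)).mpr ?_)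
  rw [← X.val_apply, X.val_eq_zero hP]

/-- The polynomials vanishing along a prime divisor which meets the open orbit. -/
def vanishingIdeal {P : PrimeDivisor A} (hP : ¬ T.Invariant P) :
    Ideal (MvPolynomial (Fin r) K) where
  carrier := {p | X.ofPolynomial p ∈ P.filtration 1}
  zero_mem' := by simp
  add_mem' hp hq := by
    rw [Set.mem_ofPred_eq, map_add]
    exact add_mem hp hq
  smul_mem' c p hp := by
    rw [Set.mem_ofPred_eq, smul_eq_mul, map_mul, ← zero_add 1]
    exact P.mul_mem_filtration (X.ofPolynomial_mem_filtration hP c) hp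

theorem mem_vanishingIdeal {P : PrimeDivisor A} (hP : ¬ T.Invariant P)
    {p : MvPolynomial (Fin r) K} (hp : p ≠ 0) :
    p ∈ X.vanishingIdeal hP ↔ 1 ≤ P.ord (X.ofPolynomial p) :=
  P.mem_filtration_of_ne_zero (by
    rwa [Ne, map_eq_zero_iff _ X.ofPolynomial_injective])

theorem ofPolynomial_ne_zero {p : MvPolynomial (Fin r) K} (hp : p ≠ 0) : X.ofPolynomial p ≠ 0 := by
  rwa [Ne, map_eq_zero_iff _ X.ofPolynomial_injective]

theorem ord_ofPolynomial_nonneg {P : PrimeDivisor A} (hP : ¬ T.Invariant P)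
    {p : MvPolynomial (Fin r) K} (hp : p ≠ 0) : 0 ≤ P.ord (X.ofPolynomial p) :=
  X.ofPolynomial_mem_filtration hP p (X.ofPolynomial_ne_zero hp)

theorem ord_ofPolynomial_monomial {P : PrimeDivisor A} (hP : ¬ T.Invariant P) (u : Fin r →₀ ℕ) :
    P.ord (X.ofPolynomial (MvPolynomial.monomial u 1)) = 0 := by
  rw [ofPolynomial_monomial, one_smul, ← X.val_apply, X.val_eq_zero hP]

theorem isPrime_vanishingIdeal {P : PrimeDivisor A} (hP : ¬ T.Invariant P) :
    (X.vanishingIdeal hP).IsPrime := by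
  refine ⟨?_, fun {p q} h => ?_⟩
  · rw [Ne, Ideal.eq_top_iff_one, X.mem_vanishingIdeal hP one_ne_zero, map_one, P.ord_one]
    norm_num
  · by_cases hp : p = 0
    · exact Or.inl (hp ▸ zero_mem _)
    by_cases hq : q = 0
    · exact Or.inr (hq ▸ zero_mem _)
    rw [X.mem_vanishingIdeal hP (mul_ne_zero hp hq), map_mul,
      P.ord_mul (X.ofPolynomial_ne_zero hp) (X.ofPolynomial_ne_zero hq)] at h
    rw [X.mem_vanishingIdeal hP hp, X.mem_vanishingIdeal hP hq]
    have h1 := X.ord_ofPolynomial_nonneg hP hp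
    have h2 := X.ord_ofPolynomial_nonneg hP hq
    omega

/-- The ideal of regular functions divisible by the polynomial `f` on the open orbit. -/
def divisibleIdeal (f : MvPolynomial (Fin r) K) : Ideal A where
  carrier := {a | ∃ (u : Fin r →₀ ℕ) (p : MvPolynomial (Fin r) K),
    X.ofPolynomial (MvPolynomial.monomial u 1) * ι a = X.ofPolynomial (f * p)}
  zero_mem' := ⟨0, 0, by simp⟩
  add_mem' := by
    rintro a b ⟨u, p, hp⟩ ⟨v, q, hq⟩
    refine ⟨u + v, MvPolynomial.monomial v 1 * p + MvPolynomial.monomial u 1 * q, ?_⟩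
    rw [show MvPolynomial.monomial (u + v) (1 : K) =
      MvPolynomial.monomial u 1 * MvPolynomial.monomial v 1 by simp [MvPolynomial.monomial_mul]]
    simp only [map_add, map_mul] at hp hq ⊢
    linear_combination X.ofPolynomial (MvPolynomial.monomial v 1) * hp +
      X.ofPolynomial (MvPolynomial.monomial u 1) * hq
  smul_mem' := by
    rintro c a ⟨u, p, hp⟩
    obtain ⟨v, q, hq⟩ := X.exists_mul_eq_ofPolynomial (X.algebraMap_mem_span c)
    refine ⟨u + v, q * p, ?_⟩
    rw [show MvPolynomial.monomial (u + v) (1 : K) =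
      MvPolynomial.monomial u 1 * MvPolynomial.monomial v 1 by simp [MvPolynomial.monomial_mul]]
    rw [smul_eq_mul]
    simp only [map_mul] at hp hq ⊢
    rw [← hq]
    linear_combination X.ofPolynomial (MvPolynomial.monomial v 1) * ι c * hp

theorem divisibleIdeal_le {P : PrimeDivisor A} (hP : ¬ T.Invariant P)
    {f : MvPolynomial (Fin r) K} (hf0 : f ≠ 0) (hf : 0 < P.ord (X.ofPolynomial f)) :
    X.divisibleIdeal f ≤ P.asIdeal := by
  rintro a ⟨u, p, hp⟩
  by_cases ha0 : a = 0
  · simp [ha0]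
  have hu : MvPolynomial.monomial u (1 : K) ≠ 0 := by simp
  have hι : ι a ≠ 0 := by simpa using ha0
  have hp0 : p ≠ 0 := by
    rintro rfl
    rw [mul_zero, map_zero, mul_eq_zero] at hp
    exact hp.elim (X.ofPolynomial_ne_zero hu) hι
  rw [← P.ord_algebraMap_pos_iff ha0]
  have h := congrArg P.ord hp
  rw [P.ord_mul (X.ofPolynomial_ne_zero hu) hι, map_mul, P.ord_mul (X.ofPolynomial_ne_zero hf0)
    (X.ofPolynomial_ne_zero hp0), X.ord_ofPolynomial_monomial hP] at h
  have := X.ord_ofPolynomial_nonneg hP hp0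
  omega

/-- After clearing monomial denominators this is primality of `f` in the polynomial ring. The
denominators are harmless: `f` divides no monomial, because it vanishes along P and monomials do
not. -/
theorem isPrime_divisibleIdeal {P : PrimeDivisor A} (hP : ¬ T.Invariant P)
    {f : MvPolynomial (Fin r) K} (hfp : Prime f) (hf : 0 < P.ord (X.ofPolynomial f)) :
    (X.divisibleIdeal f).IsPrime := by
  refine ⟨fun h => P.isPrime.ne_top (top_le_iff.mp (h ▸ X.divisibleIdeal_le hP hfp.ne_zero hf)),
    fun {a b} hab => ?_⟩
  obtain ⟨w, c, hc⟩ := hab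
  obtain ⟨u, p, hp⟩ := X.exists_mul_eq_ofPolynomial (X.algebraMap_mem_span a)
  obtain ⟨v, q, hq⟩ := X.exists_mul_eq_ofPolynomial (X.algebraMap_mem_span b)
  have h1 : MvPolynomial.monomial w 1 * (p * q) =
      f * (c * (MvPolynomial.monomial u 1 * MvPolynomial.monomial v 1)) := by
    apply X.ofPolynomial_injective
    simp only [map_mul] at hc ⊢
    rw [← hp, ← hq]
    linear_combination X.ofPolynomial (MvPolynomial.monomial u 1) *
      X.ofPolynomial (MvPolynomial.monomial v 1) * hc
  have hw : ¬ f ∣ MvPolynomial.monomial w (1 : K) := by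
    rintro ⟨d, hd⟩
    have hd0 : d ≠ 0 := by
      rintro rfl
      simp at hd
    have h := X.ord_ofPolynomial_monomial hP w
    rw [hd, map_mul, P.ord_mul (X.ofPolynomial_ne_zero hfp.ne_zero) (X.ofPolynomial_ne_zero hd0)]
      at h
    have := X.ord_ofPolynomial_nonneg hP hd0
    omega
  rcases hfp.dvd_or_dvd ((hfp.dvd_or_dvd ⟨_, h1⟩).resolve_left hw) with ⟨d, rfl⟩ | ⟨d, rfl⟩
  · exact Or.inl ⟨u, d, hp⟩
  · exact Or.inr ⟨v, d, hq⟩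

theorem divisibleIdeal_ne_bot {f : MvPolynomial (Fin r) K} (hf : f ≠ 0) :
    X.divisibleIdeal f ≠ ⊥ := by
  obtain ⟨s, hs, a, ha⟩ := X.exists_mul_eq_algebraMap (X.ofPolynomial_mem_span f)
  obtain ⟨u, p, hp⟩ := X.exists_mul_eq_ofPolynomial (Submodule.subset_span ⟨s, rfl⟩)
  rw [Submodule.ne_bot_iff]
  refine ⟨a, ⟨u, p, ?_⟩, ?_⟩
  · rw [← ha, map_mul, ← hp]
    ring
  · rintro rfl
    rw [map_zero, mul_eq_zero] at ha
    exact ha.elim (X.ne_zero s) (X.ofPolynomial_ne_zero hf)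

/-- A nonzero prime inside a prime of height one equals it. So `f` alone determines P, which also
shows that `f` vanishes along no other non-invariant prime. -/
theorem divisibleIdeal_eq {P : PrimeDivisor A} (hP : ¬ T.Invariant P)
    {f : MvPolynomial (Fin r) K} (hfp : Prime f) (hf : 0 < P.ord (X.ofPolynomial f)) :
    X.divisibleIdeal f = P.asIdeal :=
  (X.isPrime_divisibleIdeal hP hfp hf).eq_of_le_of_height_eq_one P.height_eq
    (X.divisibleIdeal_ne_bot hfp.ne_zero) (X.divisibleIdeal_le hP hfp.ne_zero hf)

/-- Prime divisors are principal on the open orbit. -/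
theorem exists_ord_eq_one_of_not_invariant (X : T.CharacterSystem) {P : PrimeDivisor A}
    (hP : ¬ T.Invariant P) :
    ∃ f : FractionRing A, f ≠ 0 ∧ P.ord f = 1 ∧
      ∀ Q : PrimeDivisor A, ¬ T.Invariant Q → Q ≠ P → Q.ord f = 0 := by
  obtain ⟨a, ha, ha1⟩ := P.exists_ord_eq_one
  have ha0 : a ≠ 0 := by
    rintro rfl
    simp [PrimeDivisor.ord] at ha1
  have hι : ι a ≠ 0 := by simpa using ha0
  have hu : ∀ u : Fin r →₀ ℕ, MvPolynomial.monomial u (1 : K) ≠ 0 := by simp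
  obtain ⟨u, p, hp⟩ := X.exists_mul_eq_ofPolynomial (X.algebraMap_mem_span a)
  have hp0 : p ≠ 0 := by
    rintro rfl
    rw [map_zero, mul_eq_zero] at hp
    exact hp.elim (X.ofPolynomial_ne_zero (hu u)) hι
  have hpP : p ∈ X.vanishingIdeal hP := by
    rw [X.mem_vanishingIdeal hP hp0, ← hp, P.ord_mul (X.ofPolynomial_ne_zero (hu u)) hι, ha1,
      X.ord_ofPolynomial_monomial hP, zero_add]
  -- Unique factorization: a nonzero prime ideal of the polynomial ring contains a prime element.
  -- That it has order exactly one follows because, up to a monomial, it divides the function `a` of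
  -- order one.
  obtain ⟨f, hfP, hfp⟩ := (X.isPrime_vanishingIdeal hP).exists_mem_prime_of_ne_bot
    ((Submodule.ne_bot_iff _).mpr ⟨p, hpP, hp0⟩)
  rw [X.mem_vanishingIdeal hP hfp.ne_zero] at hfP
  have heq := X.divisibleIdeal_eq hP hfp (by omega)
  refine ⟨X.ofPolynomial f, X.ofPolynomial_ne_zero hfp.ne_zero, ?_, fun Q hQ hQP => ?_⟩
  · rw [← heq] at ha
    obtain ⟨v, q, hq⟩ := ha
    have hq0 : q ≠ 0 := by
      rintro rfl
      rw [mul_zero, map_zero, mul_eq_zero] at hq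
      exact hq.elim (X.ofPolynomial_ne_zero (hu v)) hι
    have h := congrArg P.ord hq
    rw [P.ord_mul (X.ofPolynomial_ne_zero (hu v)) hι, map_mul, P.ord_mul
      (X.ofPolynomial_ne_zero hfp.ne_zero) (X.ofPolynomial_ne_zero hq0),
      X.ord_ofPolynomial_monomial hP, ha1] at h
    have := X.ord_ofPolynomial_nonneg hP hq0
    omega
  · refine le_antisymm (not_lt.mp fun h => hQP ?_) (X.ord_ofPolynomial_nonneg hQ hfp.ne_zero)
    exact PrimeDivisor.asIdeal_injective ((X.divisibleIdeal_eq hQ hfp h).symm.trans heq)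

/-- Every divisor is linearly equivalent to an invariant one. -/
theorem exists_ord_eq_of_not_invariant (X : T.CharacterSystem) (D : WeilDivisor A) :
    ∃ f : FractionRing A, f ≠ 0 ∧ ∀ P : PrimeDivisor A, ¬ T.Invariant P → P.ord f = D P := by
  classical
  have h : ∀ P : PrimeDivisor A, ∃ f : FractionRing A, f ≠ 0 ∧
      ∀ Q : PrimeDivisor A, ¬ T.Invariant Q → Q.ord f = if Q = P then 1 else 0 := by
    intro P
    by_cases hP : T.Invariant P
    · refine ⟨1, one_ne_zero, fun Q hQ => ?_⟩
      rw [Q.ord_one, if_neg fun h : Q = P => hQ (h ▸ hP)]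
    · obtain ⟨f, hf, h1, h2⟩ := X.exists_ord_eq_one_of_not_invariant hP
      refine ⟨f, hf, fun Q hQ => ?_⟩
      split_ifs with h
      · rw [h, h1]
      · exact h2 Q hQ h
  choose f hf h using h
  refine ⟨∏ P ∈ D.support, f P ^ D P, Finset.prod_ne_zero_iff.mpr fun P _ => zpow_ne_zero _ (hf P),
    fun Q hQ => ?_⟩
  rw [Q.ord_prod _ _ fun P _ => zpow_ne_zero _ (hf P)]
  simp [Q.ord_zpow, h _ Q hQ, eq_comm]

end TorusAction.CharacterSystem

/-! ### Farkas' lemma and the rays of the cone. -/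

/-- Farkas' lemma over a linearly ordered field. -/
theorem Module.Dual.exists_eq_sum_smul_of_nonneg {𝕜 V κ : Type*} [Field 𝕜] [LinearOrder 𝕜]
    [IsStrictOrderedRing 𝕜] [AddCommGroup V] [Module 𝕜 V] (s : Finset κ)
    (a : κ → Module.Dual 𝕜 V) (b : Module.Dual 𝕜 V)
    (h : ∀ x, (∀ i ∈ s, 0 ≤ a i x) → 0 ≤ b x) :
    ∃ l : κ → 𝕜, (∀ i ∈ s, 0 ≤ l i) ∧ b = ∑ i ∈ s, l i • a i := by
  classical
  induction s using Finset.induction_on generalizing a b with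
  | empty =>
    refine ⟨0, by simp, ?_⟩
    ext x
    have h1 := h x (by simp)
    have h2 := h (-x) (by simp)
    rw [map_neg] at h2
    simpa using le_antisymm (by linarith) h1
  | insert j s hj ih =>
    by_cases hs : ∀ x, (∀ i ∈ s, 0 ≤ a i x) → 0 ≤ b x
    · obtain ⟨l, hl, rfl⟩ := ih a b hs
      refine ⟨Function.update l j 0, fun i hi => ?_, ?_⟩
      · by_cases hij : i = j
        · simp [hij]
        · rw [Function.update_of_ne hij]
          exact hl i ((Finset.mem_insert.mp hi).resolve_left hij)
      · rw [Finset.sum_insert hj, Function.update_self, zero_smul, zero_add]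
        refine Finset.sum_congr rfl fun i hi => ?_
        rw [Function.update_of_ne (ne_of_mem_of_not_mem hi hj)]
    · push Not at hs
      obtain ⟨y, hy, hby⟩ := hs
      have hjy : a j y < 0 := by
        by_contra hcon
        refine hby.not_ge (h y fun i hi => ?_)
        rcases Finset.mem_insert.mp hi with rfl | hi
        · exact not_lt.mp hcon
        · exact hy i hi
      obtain ⟨z, hz, hbz, hjz⟩ : ∃ z, (∀ i ∈ s, 0 ≤ a i z) ∧ b z < 0 ∧ a j z = -1 := by
        have hpos : 0 < (-(a j y))⁻¹ := inv_pos.mpr (neg_pos.mpr hjy)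
        refine ⟨(-(a j y))⁻¹ • y, fun i hi => ?_, ?_, ?_⟩
        · rw [map_smul, smul_eq_mul]
          exact mul_nonneg hpos.le (hy i hi)
        · rw [map_smul, smul_eq_mul]
          exact mul_neg_of_pos_of_neg hpos hby
        · rw [map_smul, smul_eq_mul]
          have := hjy.ne
          field_simp
      -- Since a_j(z) = -1, the map x ↦ x + a_j(x) z projects onto the hyperplane a_j = 0. Pulling
      -- back all functionals along it removes the constraint `j`; the coefficient recovered for a_j
      -- is nonnegative because b(z) < 0 and the other a_i(z) are nonnegative.
      obtain ⟨l, hl, hbl⟩ := ih (fun i => a i + a i z • a j) (b + b z • a j) (by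
        intro x hx
        have h1 : ∀ c : Module.Dual 𝕜 V, (c + c z • a j) x = c (x + a j x • z) := fun c => by
          simp [mul_comm]
        simp only [h1] at hx ⊢
        refine h _ fun i hi => ?_
        rcases Finset.mem_insert.mp hi with rfl | hi
        · simp [hjz]
        · exact hx i hi)
      refine ⟨Function.update l j (∑ i ∈ s, l i * a i z - b z), fun i hi => ?_, ?_⟩
      · by_cases hij : i = j
        · rw [hij, Function.update_self]
          have := Finset.sum_nonneg fun i hi => mul_nonneg (hl i hi) (hz i hi)
          linarith
        · rw [Function.update_of_ne hij]
          exact hl i ((Finset.mem_insert.mp hi).resolve_left hij)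
      · rw [Finset.sum_insert hj, Function.update_self]
        have h2 : ∑ i ∈ s, Function.update l j (∑ i ∈ s, l i * a i z - b z) i • a i =
            ∑ i ∈ s, l i • a i := Finset.sum_congr rfl fun i hi => by
          rw [Function.update_of_ne (ne_of_mem_of_not_mem hi hj)]
        rw [h2]
        ext x
        have h3 := LinearMap.congr_fun hbl x
        simp only [LinearMap.add_apply, LinearMap.smul_apply, LinearMap.sum_apply, smul_eq_mul,
          mul_add, Finset.sum_add_distrib, ← mul_assoc, ← Finset.sum_mul] at h3 ⊢
        linear_combination h3

theorem exists_nat_smul_eq_intCast {r : ℕ} (x : Fin r → ℚ) :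
    ∃ (N : ℕ) (m : Fin r → ℤ), 0 < N ∧ (fun i => (m i : ℚ)) = (N : ℚ) • x := by
  refine ⟨∏ i, (x i).den, fun i => (x i).num * ∏ j ∈ Finset.univ.erase i, ((x j).den : ℤ),
    Finset.prod_pos fun i _ => (x i).den_pos, ?_⟩
  funext i
  rw [← Finset.mul_prod_erase Finset.univ _ (Finset.mem_univ i)]
  have := Rat.mul_den_eq_num (x i)
  simp only [Pi.smul_apply, smul_eq_mul]
  push_cast
  rw [← this]
  ring

namespace TorusAction.CharacterSystem

variable {K : Type*} [Field K] {r : ℕ} {A : Type*} [CommRing A] [IsDomain A] [Algebra K A]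
variable {T : TorusAction K r A} (X : T.CharacterSystem)

local notation "ι" => algebraMap A (FractionRing A)

theorem mem_cone_iff {v : Fin r → ℚ} :
    v ∈ T.cone ↔ ∀ m ∈ X.regular, 0 ≤ (fun i => (m i : ℚ)) ⬝ᵥ v := by
  constructor
  · rintro h m ⟨a, ha⟩
    exact h ⟨m, a, X.ne_zero_of_eq ha, X.isWeightVector m a ha, rfl⟩
  · rintro h _ ⟨m, a, ha0, ha, rfl⟩
    exact h m (X.mem_regular_of_isWeightVector ha0 ha)

variable [CharZero K] [IsNoetherianRing A] [IsIntegrallyClosed A]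

/-- The orders of the basic characters along `P`, as a vector in `N_ℚ`. -/
def valVec (P : PrimeDivisor A) : Fin r → ℚ := fun i => X.val P (Pi.single i 1)

theorem dotProduct_valVec (P : PrimeDivisor A) (m : Fin r → ℤ) :
    (fun i => (m i : ℚ)) ⬝ᵥ X.valVec P = X.val P m := by
  conv_rhs => rw [← Finset.univ_sum_single m]
  rw [map_sum, Int.cast_sum, dotProduct]
  refine Finset.sum_congr rfl fun i _ => ?_
  rw [valVec, ← Int.cast_mul, ← smul_eq_mul, ← map_zsmul, ← Pi.single_smul, smul_eq_mul, mul_one]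

theorem valVec_mem_cone (P : PrimeDivisor A) : X.valVec P ∈ T.cone := by
  rw [X.mem_cone_iff]
  intro m hm
  rw [dotProduct_valVec]
  exact_mod_cast X.val_nonneg P hm

theorem valVec_ne_zero {P : PrimeDivisor A} (hP : T.Invariant P) : X.valVec P ≠ 0 := by
  intro h
  obtain ⟨m, -, hm⟩ := X.exists_val_pos hP
  have := X.dotProduct_valVec P m
  rw [h, dotProduct_zero] at this
  exact hm.ne (by exact_mod_cast this)

variable [IsAlgClosed K] [Fintype {P : PrimeDivisor A // T.Invariant P}]

/-- Farkas' lemma: a rational vector nonnegative on all the order vectors becomes, after clearing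
denominators, a regular weight by `mem_regular_iff`, and such weights are nonnegative on σ by
definition. -/
theorem exists_eq_sum_valVec {v : Fin r → ℚ} (hv : v ∈ T.cone) :
    ∃ l : {P : PrimeDivisor A // T.Invariant P} → ℚ, (∀ P, 0 ≤ l P) ∧
      v = ∑ P, l P • X.valVec P.1 := by
  obtain ⟨l, hl, h⟩ := Module.Dual.exists_eq_sum_smul_of_nonneg Finset.univ
    (fun P : {P : PrimeDivisor A // T.Invariant P} => (dotProductBilin ℚ ℚ).flip (X.valVec P.1))
    ((dotProductBilin ℚ ℚ).flip v) (by
      intro x hx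
      obtain ⟨N, m, hN, hm⟩ := exists_nat_smul_eq_intCast x
      have hN' : (0 : ℚ) < N := by exact_mod_cast hN
      have hmr : m ∈ X.regular := by
        rw [X.mem_regular_iff]
        intro P hP
        have h1 : 0 ≤ x ⬝ᵥ X.valVec P := hx ⟨P, hP⟩ (Finset.mem_univ _)
        have h2 := X.dotProduct_valVec P m
        rw [hm, smul_dotProduct, smul_eq_mul] at h2
        have h3 : (0 : ℚ) ≤ X.val P m := h2 ▸ mul_nonneg hN'.le h1
        exact_mod_cast h3
      have h1 := (X.mem_cone_iff.mp hv) m hmr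
      rw [hm, smul_dotProduct, smul_eq_mul] at h1
      exact nonneg_of_mul_nonneg_right h1 hN')
  refine ⟨l, fun P => hl P (Finset.mem_univ _), ?_⟩
  funext i
  have := LinearMap.congr_fun h (Pi.single i 1)
  simpa using this

theorem mem_hull_valVec_iff {P : PrimeDivisor A} {v : Fin r → ℚ} :
    v ∈ PointedCone.hull ℚ {X.valVec P} ↔ ∃ c : ℚ, 0 ≤ c ∧ v = c • X.valVec P := by
  rw [Submodule.mem_span_singleton]
  constructor
  · rintro ⟨c, rfl⟩
    exact ⟨c.1, c.2, rfl⟩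
  · rintro ⟨c, hc, rfl⟩
    exact ⟨⟨c, hc⟩, rfl⟩

variable [Algebra.FiniteType K A]

theorem isFaceOf_hull_valVec (P : {P : PrimeDivisor A // T.Invariant P}) :
    (PointedCone.hull ℚ {X.valVec P.1}).IsFaceOf T.cone := by
  obtain ⟨m, hm, hmP, hmQ⟩ := X.exists_val_eq_zero_iff P
  refine ⟨?_, fun {x y a} hx hy ha h => ?_⟩
  · rw [PointedCone.hull, Submodule.span_singleton_le_iff_mem]
    exact X.valVec_mem_cone _
  rw [mem_hull_valVec_iff] at h ⊢
  obtain ⟨c, hc, h⟩ := h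
  have h1 := congrArg (fun v => (fun i => (m i : ℚ)) ⬝ᵥ v) h
  simp only [dotProduct_add, dotProduct_smul, dotProduct_valVec, hmP, smul_eq_mul] at h1
  have hx' := X.mem_cone_iff.mp hx m hm
  have hy' := X.mem_cone_iff.mp hy m hm
  -- The functional `m` is nonnegative on σ and vanishes on `a • x + y`, hence on `x`. Being
  -- positive on every other generator, it leaves only the multiple of the vector of P in the
  -- decomposition of `x`.
  have hx0 : (fun i => (m i : ℚ)) ⬝ᵥ x = 0 := by
    have : a * (fun i => (m i : ℚ)) ⬝ᵥ x ≤ 0 := by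
      push_cast at h1
      linarith
    exact le_antisymm (nonpos_of_mul_nonpos_right this ha) hx'
  obtain ⟨l, hl, rfl⟩ := X.exists_eq_sum_valVec hx
  refine ⟨l P, hl P, ?_⟩
  rw [dotProduct_sum] at hx0
  simp only [dotProduct_smul, dotProduct_valVec, smul_eq_mul] at hx0
  rw [Finset.sum_eq_zero_iff_of_nonneg fun Q _ => mul_nonneg (hl Q)
    (by exact_mod_cast X.val_nonneg Q.1 hm)] at hx0
  refine Finset.sum_eq_single P (fun Q _ hQ => ?_) (by simp)
  have h3 : (0 : ℚ) < X.val Q.1 m := by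
    exact_mod_cast hmQ Q.1 Q.2 fun h => hQ (Subtype.ext h)
  rw [(mul_eq_zero.mp (hx0 Q (Finset.mem_univ _))).resolve_right h3.ne', zero_smul]

/-- The ray spanned by the valuation of an invariant prime divisor. -/
def ray (P : {P : PrimeDivisor A // T.Invariant P}) : T.Ray :=
  ⟨PointedCone.hull ℚ {X.valVec P.1}, X.isFaceOf_hull_valVec P, by
    rw [PointedCone.hull, Submodule.span_span_of_tower, finrank_span_singleton
      (X.valVec_ne_zero P.2)]⟩

/-- Pairing a weight with the generator of the ray gives its order along P, so the generators of the
ray ideal vanish along P; conversely elements of the invariant prime expand into characters of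
positive order. Injectivity of `ray` follows, as P is recovered from its ray. -/
theorem rayIdeal_ray (P : {P : PrimeDivisor A // T.Invariant P}) :
    T.rayIdeal (X.ray P) = P.1.asIdeal := by
  apply le_antisymm
  · rw [rayIdeal, Ideal.span_le]
    rintro a ⟨m, ha, v, hv, hpos⟩
    obtain ⟨d, hd⟩ := X.eq_smul m a ha
    obtain ⟨c, hc, rfl⟩ := X.mem_hull_valVec_iff.mp hv
    refine X.mem_of_val_pos P.1 (F := {m}) (c := fun _ => d) (by simpa using hd) ?_
    rw [dotProduct_smul, dotProduct_valVec, smul_eq_mul] at hpos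
    simpa using pos_of_mul_pos_right hpos hc
  · intro a ha
    obtain ⟨F, c, hc, hF, h⟩ := X.exists_expansion a
    choose e he using hF
    have hsum : a = ∑ m : F, c m • e m.1 m.2 := by
      apply FaithfulSMul.algebraMap_injective A (FractionRing A)
      rw [h, map_sum, ← Finset.sum_coe_sort]
      refine Finset.sum_congr rfl fun m _ => ?_
      rw [Algebra.smul_def (c m) (e m.1 m.2), map_mul, ← IsScalarTower.algebraMap_apply,
        ← Algebra.smul_def, he]
    rw [hsum]
    refine sum_mem fun m _ => ?_
    rw [Algebra.smul_def]
    refine Ideal.mul_mem_left _ _ (Ideal.subset_span ⟨m.1, X.isWeightVector _ _ (he m.1 m.2),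
      X.valVec P.1, PointedCone.subset_hull rfl, ?_⟩)
    rw [dotProduct_valVec]
    exact_mod_cast X.val_pos_of_mem P.2 ha hc (fun m hm => ⟨e m hm, he m hm⟩) h m.2

theorem ray_injective : Function.Injective X.ray := fun P Q h => by
  refine Subtype.ext (PrimeDivisor.asIdeal_injective ?_)
  simp only [← rayIdeal_ray X, h]

theorem nonneg_of_smul_valVec_mem_cone {P : PrimeDivisor A} (hP : T.Invariant P) {c : ℚ}
    (h : c • X.valVec P ∈ T.cone) : 0 ≤ c := by
  obtain ⟨m, hm, hpos⟩ := X.exists_val_pos hP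
  have h1 := X.mem_cone_iff.mp h m hm
  rw [dotProduct_smul, dotProduct_valVec, smul_eq_mul] at h1
  exact nonneg_of_mul_nonneg_left h1 (by exact_mod_cast hpos)

theorem exists_hull_valVec_eq {ρ : PointedCone ℚ (Fin r → ℚ)} (hface : ρ.IsFaceOf T.cone)
    (hdim : Module.finrank ℚ (Submodule.span ℚ (ρ : Set (Fin r → ℚ))) = 1) :
    ∃ P : {P : PrimeDivisor A // T.Invariant P}, PointedCone.hull ℚ {X.valVec P.1} = ρ := by
  obtain ⟨v, hv, hv0⟩ : ∃ v ∈ ρ, v ≠ 0 := by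
    by_contra! h
    rw [(Submodule.span_eq_bot (R := ℚ) (s := (ρ : Set (Fin r → ℚ)))).mpr h, finrank_bot] at hdim
    exact zero_ne_one hdim
  obtain ⟨l, hl, rfl⟩ := X.exists_eq_sum_valVec (hface.le hv)
  obtain ⟨P, hP⟩ : ∃ P, l P ≠ 0 := by
    by_contra! h
    exact hv0 (by simp [h])
  have hpos : 0 < l P := lt_of_le_of_ne (hl P) (Ne.symm hP)
  -- A nonzero vector of the face involves some generator with positive coefficient, and the face
  -- property puts that generator in ρ. Dimension one then confines ρ to its line, and σ excludes
  -- negative multiples.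
  have hPρ : X.valVec P.1 ∈ ρ := by
    classical
    rw [← Finset.add_sum_erase _ _ (Finset.mem_univ P)] at hv
    refine hface.mem_of_smul_add_mem (X.valVec_mem_cone P.1) ?_ hpos hv
    exact sum_mem fun Q _ => T.cone.smul_mem (hl Q) (X.valVec_mem_cone Q.1)
  refine ⟨P, le_antisymm ?_ fun w hw => ?_⟩
  · rw [PointedCone.hull, Submodule.span_singleton_le_iff_mem]
    exact hPρ
  · rw [mem_hull_valVec_iff]
    have hspan : Submodule.span ℚ {X.valVec P.1} = Submodule.span ℚ (ρ : Set (Fin r → ℚ)) :=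
      Submodule.eq_of_le_of_finrank_eq (Submodule.span_mono (Set.singleton_subset_iff.mpr hPρ))
        (by rw [finrank_span_singleton (X.valVec_ne_zero P.2), hdim])
    have hw' : w ∈ Submodule.span ℚ {X.valVec P.1} := hspan ▸ Submodule.subset_span hw
    obtain ⟨c, rfl⟩ := Submodule.mem_span_singleton.mp hw'
    exact ⟨c, X.nonneg_of_smul_valVec_mem_cone P.2 (hface.le hw), rfl⟩

theorem ray_surjective : Function.Surjective X.ray := by
  rintro ⟨ρ, hface, hdim⟩
  obtain ⟨P, hP⟩ := X.exists_hull_valVec_eq hface hdim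
  exact ⟨P, Subtype.ext hP⟩

/-- The rays of the cone are in bijection with the invariant prime divisors. -/
def rayEquiv : T.Ray ≃ {P : PrimeDivisor A // T.Invariant P} :=
  (Equiv.ofBijective X.ray ⟨X.ray_injective, X.ray_surjective⟩).symm

theorem asIdeal_rayEquiv (ρ : T.Ray) : (X.rayEquiv ρ).1.asIdeal = T.rayIdeal ρ := by
  obtain ⟨P, rfl⟩ := X.ray_surjective ρ
  have h : X.rayEquiv (X.ray P) = P := Equiv.symm_apply_apply (Equiv.ofBijective X.ray _) P
  rw [X.rayIdeal_ray, h]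

end TorusAction.CharacterSystem

/-! ### Divisor classes and homogeneous sections. -/

open scoped DirectSum

section

variable {A : Type*} [CommRing A] [IsDomain A] [IsNoetherianRing A] [IsIntegrallyClosed A]

variable (A) in
/-- The class of a divisor as a homomorphism. -/
def divisorClassHom : WeilDivisor A →+ DivisorClassGroup A := QuotientAddGroup.mk' _

@[simp]
theorem divisorClassHom_apply (D : WeilDivisor A) : divisorClassHom A D = divisorClass D := rfl

theorem divisorClass_surjective : Function.Surjective (divisorClass (A := A)) :=
  QuotientAddGroup.mk_surjective

/-- The structure theorem supplies the decomposition; k_j W_j has trivial class, which is precisely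
the existence of F_j. -/
theorem ClassGroupSplitting.nonempty_of_fg [AddGroup.FG (DivisorClassGroup A)] :
    Nonempty (ClassGroupSplitting A) := by
  classical
  obtain ⟨n, κ, _, p, hp, e, ⟨f⟩⟩ :=
    AddCommGroup.equiv_free_prod_directSum_zmod (DivisorClassGroup A)
  let σ := (Fintype.equivFin κ).symm
  let k : Fin (Fintype.card κ) → ℕ := fun j => p (σ j) ^ e (σ j)
  let g2 : ((j : Fin (Fintype.card κ)) → ZMod (k j)) ≃+ ⨁ i : κ, ZMod (p i ^ e i) :=
    (RingEquiv.piCongrLeft (fun i => ZMod (p i ^ e i)) σ).toAddEquiv.trans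
      (DirectSum.addEquivProd fun i => ZMod (p i ^ e i)).symm
  let g : ((Fin n → ℤ) × ((j : Fin (Fintype.card κ)) → ZMod (k j))) ≃+ DivisorClassGroup A :=
    ((Finsupp.linearEquivFunOnFinite ℤ ℤ (Fin n)).symm.toAddEquiv.prodCongr g2).trans f.symm
  choose E hE using fun i => divisorClass_surjective (g (Pi.single i 1, 0))
  choose W hW using fun j => divisorClass_surjective (g (0, Pi.single j 1))
  have hF : ∀ j, ∃ F : FractionRing A, IsDivisorOf F (k j • W j) := by
    intro j
    have h : k j • W j ∈ principalDivisors A := by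
      rw [← QuotientAddGroup.eq_zero_iff]
      change divisorClassHom A (k j • W j) = 0
      rw [map_nsmul, divisorClassHom_apply, hW, ← map_nsmul, Prod.smul_mk, smul_zero,
        ← Pi.single_smul, nsmul_eq_mul, ZMod.natCast_self, zero_mul, Pi.single_zero]
      exact map_zero g
    exact h
  choose F hF using hF
  exact ⟨⟨n, _, k, fun j => ⟨pow_ne_zero _ (hp _).ne_zero⟩, g, E, W, hE, hW, F, hF⟩⟩

end

namespace ClassGroupSplitting

variable {A : Type*} [CommRing A] [IsDomain A] [IsNoetherianRing A] [IsIntegrallyClosed A]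
variable (𝒮 : ClassGroupSplitting A)

theorem divisorClass_rep (g : 𝒮.Degree) : divisorClass (𝒮.rep g) = 𝒮.equiv g := by
  have h : g = ∑ i, g.1 i • ((Pi.single i 1, 0) : 𝒮.Degree) +
      ∑ j, (g.2 j).val • ((0, Pi.single j 1) : 𝒮.Degree) := by
    have := 𝒮.k_neZero
    refine Prod.ext ?_ ?_
    · simp [Prod.fst_sum, ← Pi.single_smul, Finset.univ_sum_single]
    · simp only [Prod.snd_add, Prod.snd_sum, Prod.smul_snd, smul_zero, Finset.sum_const_zero,
        zero_add, ← Pi.single_smul]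
      simp only [nsmul_eq_mul, mul_one, ZMod.natCast_zmod_val, Finset.univ_sum_single]
  conv_rhs => rw [h]
  rw [← divisorClassHom_apply, rep]
  simp only [map_add, map_sum, map_zsmul, map_nsmul, divisorClassHom_apply, 𝒮.class_E, 𝒮.class_W]

variable (K : Type*) [Field K] [Algebra K A]

/-- `x` is the homogeneous element of degree `g` defined by a section of the divisor `rep g`
whose divisor of zeros is `D`. -/
def IsSection (x : 𝒮.TotalCoordinateRing K) (g : 𝒮.Degree) (D : WeilDivisor A) : Prop :=
  ∃ f : 𝒮.Component K g, x = DirectSum.of (𝒮.Component K) g f ∧ f.1 ≠ 0 ∧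
    ∀ P : PrimeDivisor A, P.ord f.1 + 𝒮.rep g P = D P

variable {K} {𝒮}

theorem isSection_one : 𝒮.IsSection K 1 0 0 := by
  refine ⟨𝒮.const K 1, rfl, ?_, fun P => ?_⟩
  · change algebraMap K (FractionRing A) 1 ≠ 0
    simp
  · change P.ord (algebraMap K (FractionRing A) 1) + _ = _
    simp [P.ord_one, 𝒮.rep_zero]

/-- The divisor of the correction factor is `rep g + rep h - rep (g + h)`, so the twist by the F_j
makes divisors of zeros additive. -/
theorem IsSection.mul {x y : 𝒮.TotalCoordinateRing K} {g h : 𝒮.Degree} {D E : WeilDivisor A}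
    (hx : 𝒮.IsSection K x g D) (hy : 𝒮.IsSection K y h E) :
    𝒮.IsSection K (x * y) (g + h) (D + E) := by
  obtain ⟨a, rfl, ha0, ha⟩ := hx
  obtain ⟨b, rfl, hb0, hb⟩ := hy
  refine ⟨GradedMonoid.GMul.mul a b, DirectSum.of_mul_of _ _, ?_, fun P => ?_⟩
  · exact mul_ne_zero (mul_ne_zero ha0 hb0) (𝒮.correction_ne_zero g h)
  · change P.ord (a.1 * b.1 * 𝒮.correction g h) + _ = _
    rw [P.ord_mul (mul_ne_zero ha0 hb0) (𝒮.correction_ne_zero g h), P.ord_mul ha0 hb0,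
      Finsupp.add_apply, ← ha, ← hb, add_assoc, 𝒮.ord_correction]
    ring

theorem IsSection.pow {x : 𝒮.TotalCoordinateRing K} {g : 𝒮.Degree} {D : WeilDivisor A}
    (hx : 𝒮.IsSection K x g D) (n : ℕ) : 𝒮.IsSection K (x ^ n) (n • g) (n • D) := by
  induction n with
  | zero => simpa using isSection_one
  | succ n ih => simpa only [pow_succ, succ_nsmul] using ih.mul hx

theorem isSection_prod {κ : Type*} (s : Finset κ) {x : κ → 𝒮.TotalCoordinateRing K}
    {g : κ → 𝒮.Degree} {D : κ → WeilDivisor A} (hx : ∀ i ∈ s, 𝒮.IsSection K (x i) (g i) (D i)) :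
    𝒮.IsSection K (∏ i ∈ s, x i) (∑ i ∈ s, g i) (∑ i ∈ s, D i) := by
  induction s using Finset.cons_induction with
  | empty => simpa using isSection_one
  | cons i s hi ih =>
    rw [Finset.prod_cons, Finset.sum_cons, Finset.sum_cons]
    exact (hx i (by simp)).mul (ih fun j hj => hx j (by simp [hj]))

theorem exists_isSection {g : 𝒮.Degree} {D : WeilDivisor A} (hD : 0 ≤ D)
    (h : divisorClass D = 𝒮.equiv g) : ∃ x, 𝒮.IsSection K x g D := by
  rw [← divisorClass_rep, divisorClass_eq_iff] at h
  obtain ⟨f, hf0, hf⟩ := h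
  refine ⟨_, (⟨f, fun _ P => ?_⟩ : 𝒮.Component K g), rfl, hf0, fun P => ?_⟩
  · rw [hf, sub_add_cancel]
    exact hD P
  · rw [hf, sub_add_cancel]

end ClassGroupSplitting

/-! ### Comparison of the Cox ring with S(X). -/

namespace TorusAction.CharacterSystem

variable {K : Type*} [Field K] [IsAlgClosed K] [CharZero K] {A : Type*} [CommRing A] [IsDomain A]
  [Algebra K A] [Algebra.FiniteType K A] [IsNoetherianRing A] [IsIntegrallyClosed A]
  {r : ℕ} {T : TorusAction K r A} (X : T.CharacterSystem) {R : Type*} [Fintype R]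
  (D : R ≃ {P : PrimeDivisor A // T.Invariant P})

/-- The effective invariant divisor attached to a monomial of the Cox ring. -/
def monomialDivisor (c : R →₀ ℕ) : WeilDivisor A := ∑ ρ, c ρ • Finsupp.single (D ρ).1 1

theorem monomialDivisor_apply (c : R →₀ ℕ) (ρ : R) : monomialDivisor D c (D ρ).1 = c ρ := by
  classical
  simp [monomialDivisor, Finsupp.finsetSum_apply, Finsupp.single_apply, ← Subtype.ext_iff,
    D.injective.eq_iff]

theorem monomialDivisor_apply_of_not_invariant (c : R →₀ ℕ) {P : PrimeDivisor A}
    (hP : ¬ T.Invariant P) : monomialDivisor D c P = 0 := by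
  classical
  rw [monomialDivisor, Finsupp.finsetSum_apply]
  refine Finset.sum_eq_zero fun ρ _ => ?_
  rw [Finsupp.smul_apply, Finsupp.single_eq_of_ne, smul_zero]
  rintro rfl
  exact hP (D ρ).2

theorem divisorClass_monomialDivisor (c : R →₀ ℕ) : divisorClass (monomialDivisor D c) =
    Finsupp.weight (fun ρ => divisorClass (Finsupp.single (D ρ).1 1)) c := by
  rw [← divisorClassHom_apply, monomialDivisor, map_sum, Finsupp.weight_apply,
    Finsupp.sum_fintype _ _ (by simp)]
  exact Finset.sum_congr rfl fun ρ _ => map_nsmul _ _ _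

/-- Every divisor is linearly equivalent to one supported on the finitely many invariant primes. -/
theorem fg_divisorClassGroup (X : T.CharacterSystem) : AddGroup.FG (DivisorClassGroup A) := by
  have := X.finite_invariant
  let _ := Fintype.ofFinite {P : PrimeDivisor A // T.Invariant P}
  rw [AddGroup.fg_iff]
  refine ⟨Set.range fun P : {P : PrimeDivisor A // T.Invariant P} =>
    divisorClass (Finsupp.single P.1 1), eq_top_iff.mpr fun x _ => ?_, Set.finite_range _⟩
  obtain ⟨E, rfl⟩ := divisorClass_surjective x
  obtain ⟨f, hf0, hf⟩ := X.exists_ord_eq_of_not_invariant E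
  have h : divisorClass E = divisorClass (∑ P : {P : PrimeDivisor A // T.Invariant P},
      (E P.1 - P.1.ord f) • Finsupp.single P.1 (1 : ℤ)) := by
    classical
    rw [divisorClass_eq_iff]
    refine ⟨f, hf0, fun Q => ?_⟩
    rw [Finsupp.finsetSum_apply]
    by_cases hQ : T.Invariant Q
    · rw [Finset.sum_eq_single ⟨Q, hQ⟩]
      · simp
      · rintro P - hP
        rw [Finsupp.smul_apply, Finsupp.single_eq_of_ne, smul_zero]
        rintro rfl
        exact hP rfl
      · simp
    · rw [Finset.sum_eq_zero, sub_zero, hf Q hQ]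
      rintro P -
      rw [Finsupp.smul_apply, Finsupp.single_eq_of_ne, smul_zero]
      rintro rfl
      exact hQ P.2
  rw [h, ← divisorClassHom_apply, map_sum]
  refine sum_mem fun P _ => ?_
  rw [map_zsmul]
  exact AddSubgroup.zsmul_mem _ (AddSubgroup.subset_closure (Set.mem_range_self P)) _

variable (𝒮 : ClassGroupSplitting A)

theorem exists_isSection_variable (ρ : R) : ∃ x, 𝒮.IsSection K x
    (𝒮.equiv.symm (divisorClass (Finsupp.single (D ρ).1 1))) (Finsupp.single (D ρ).1 1) :=
  ClassGroupSplitting.exists_isSection (Finsupp.single_nonneg.mpr zero_le_one) (by simp)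

/-- The homomorphism from the Cox ring to the total coordinate ring which sends the variables to
the canonical sections of the invariant prime divisors. -/
def coxHom : MvPolynomial R K →ₐ[K] 𝒮.TotalCoordinateRing K :=
  MvPolynomial.aeval fun ρ => (exists_isSection_variable (K := K) D 𝒮 ρ).choose

theorem isSection_coxHom_monomial (c : R →₀ ℕ) {g : 𝒮.Degree}
    (hg : divisorClass (monomialDivisor D c) = 𝒮.equiv g) :
    𝒮.IsSection K (coxHom D 𝒮 (MvPolynomial.monomial c 1)) g (monomialDivisor D c) := by
  have h1 : g = ∑ ρ, c ρ • 𝒮.equiv.symm (divisorClass (Finsupp.single (D ρ).1 1)) := by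
    apply 𝒮.equiv.injective
    rw [← hg, divisorClass_monomialDivisor, Finsupp.weight_apply,
      Finsupp.sum_fintype _ _ (by simp), map_sum]
    refine Finset.sum_congr rfl fun ρ _ => ?_
    rw [map_nsmul, AddEquiv.apply_symm_apply]
  have h2 : coxHom (K := K) D 𝒮 (MvPolynomial.monomial c 1) =
      ∏ ρ, (exists_isSection_variable (K := K) D 𝒮 ρ).choose ^ c ρ := by
    rw [coxHom, MvPolynomial.aeval_monomial, map_one]
    refine Eq.trans (one_mul (M := 𝒮.TotalCoordinateRing K) _) ?_
    exact Finsupp.prod_fintype _ _ fun ρ => pow_zero _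
  rw [h1, h2]
  exact ClassGroupSplitting.isSection_prod _ fun ρ _ =>
    (exists_isSection_variable (K := K) D 𝒮 ρ).choose_spec.pow _

theorem mem_weightedHomogeneousSubmodule_iff (p : MvPolynomial R K) (g : 𝒮.Degree) :
    p ∈ MvPolynomial.weightedHomogeneousSubmodule K
      (fun ρ => divisorClass (Finsupp.single (D ρ).1 1)) (𝒮.equiv g) ↔
    ∀ c, p.coeff c ≠ 0 → divisorClass (monomialDivisor D c) = 𝒮.equiv g := by
  simp only [MvPolynomial.mem_weightedHomogeneousSubmodule, MvPolynomial.IsWeightedHomogeneous,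
    divisorClass_monomialDivisor]

variable (hunits : ∀ u : A, IsUnit u → ∃ c : K, algebraMap K A c = u)

include X hunits

/-- A section times `h` is regular on the open orbit, hence a sum of characters, and each χᵐ/h is
again a section, with effective invariant divisor of zeros. The monomial with that divisor maps to a
section with the same divisor, so the two are proportional. -/
theorem range_lof_le (g : 𝒮.Degree) :
    LinearMap.range (DirectSum.lof K 𝒮.Degree (𝒮.Component K) g) ≤
      (MvPolynomial.weightedHomogeneousSubmodule K
        (fun ρ => divisorClass (Finsupp.single (D ρ).1 1)) (𝒮.equiv g)).map
          (coxHom (K := K) D 𝒮).toLinearMap := by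
  rintro _ ⟨⟨f, hf⟩, rfl⟩
  by_cases hf0 : f = 0
  · subst hf0
    rw [show (⟨0, hf⟩ : 𝒮.Component K g) = 0 from rfl, map_zero]
    exact zero_mem _
  obtain ⟨h, hh0, hh⟩ := X.exists_ord_eq_of_not_invariant (𝒮.rep g)
  obtain ⟨F, c, hsum, hF⟩ := X.exists_expansion_of_ord_nonneg (mul_ne_zero hf0 hh0) fun P hP => by
    rw [P.ord_mul hf0 hh0, hh P hP]
    exact hf hf0 P
  let Z : Submodule K (FractionRing A) := (((MvPolynomial.weightedHomogeneousSubmodule K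
    (fun ρ => divisorClass (Finsupp.single (D ρ).1 1)) (𝒮.equiv g)).map
      (coxHom (K := K) D 𝒮).toLinearMap).comap
        (DirectSum.lof K 𝒮.Degree (𝒮.Component K) g)).map (Submodule.subtype _)
  suffices f ∈ Z by
    obtain ⟨⟨f', hf'⟩, hZ, rfl⟩ := this
    exact hZ
  have hfsum : f = ∑ m ∈ F, c m • (X.χ m / h) := by
    rw [← mul_left_inj' hh0, hsum, Finset.sum_mul]
    refine Finset.sum_congr rfl fun m _ => ?_
    rw [smul_mul_assoc, div_mul_cancel₀ _ hh0]
  rw [hfsum]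
  refine sum_mem fun m hm => Z.smul_mem _ ?_
  have hord : ∀ P : PrimeDivisor A, P.ord (X.χ m / h) = X.val P m - P.ord h := fun P => by
    rw [P.ord_div (X.ne_zero m) hh0, X.val_apply]
  -- The multiplicities of the divisor of zeros of χᵐ/h; `toNat` loses nothing since ord(f h) ≤
  -- val(m) and f is a section.
  let e : R →₀ ℕ := Finsupp.equivFunOnFinite.symm fun ρ =>
    (X.val (D ρ).1 m - (D ρ).1.ord h + 𝒮.rep g (D ρ).1).toNat
  have he : ∀ P : PrimeDivisor A, P.ord (X.χ m / h) = monomialDivisor D e P - 𝒮.rep g P := by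
    intro P
    rw [hord]
    by_cases hP : T.Invariant P
    · obtain ⟨ρ, hρ⟩ := D.surjective ⟨P, hP⟩
      obtain rfl : (D ρ).1 = P := congrArg Subtype.val hρ
      have h1 := hF m hm _ hP
      have h2 := hf hf0 (D ρ).1
      rw [(D ρ).1.ord_mul hf0 hh0] at h1
      rw [monomialDivisor_apply, Finsupp.equivFunOnFinite_symm_apply_apply, Int.toNat_of_nonneg]
      · ring
      · linarith
    · rw [monomialDivisor_apply_of_not_invariant D e hP, X.val_eq_zero hP, hh P hP]
  have hcls : divisorClass (monomialDivisor D e) = 𝒮.equiv g := by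
    rw [← 𝒮.divisorClass_rep, divisorClass_eq_iff]
    exact ⟨_, div_ne_zero (X.ne_zero m) hh0, he⟩
  obtain ⟨q, hq, hq0, hqd⟩ := isSection_coxHom_monomial (K := K) D 𝒮 e hcls
  obtain ⟨d, hd0, hd⟩ := PrimeDivisor.eq_smul_of_ord_eq hunits
    (div_ne_zero (X.ne_zero m) hh0) hq0 fun P => by
      rw [he, ← hqd]
      ring
  rw [hd]
  refine Z.smul_mem _ ⟨q, ⟨MvPolynomial.monomial e 1, ?_, hq⟩, rfl⟩
  classical
  rw [SetLike.mem_coe, mem_weightedHomogeneousSubmodule_iff]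
  intro c' hc'
  rw [MvPolynomial.coeff_monomial] at hc'
  obtain rfl : e = c' := by
    by_contra hne
    exact hc' (if_neg hne)
  exact hcls

/-- Project to the degree of a given monomial and multiply by `h`: the images of the monomials of
that degree become nonzero multiples of characters. Distinct monomials have distinct divisors, so
these characters are distinct and independent. -/
theorem coxHom_injective : Function.Injective (coxHom (K := K) D 𝒮) := by
  classical
  rw [injective_iff_map_eq_zero]
  intro p hp
  ext c₀
  rw [MvPolynomial.coeff_zero]
  let g := 𝒮.equiv.symm (divisorClass (monomialDivisor D c₀))
  obtain ⟨h, hh0, hh⟩ := X.exists_ord_eq_of_not_invariant (𝒮.rep g)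
  have hsec : ∀ c : {c : R →₀ ℕ // divisorClass (monomialDivisor D c) = 𝒮.equiv g},
      ∃ q : 𝒮.Component K g, coxHom D 𝒮 (MvPolynomial.monomial c.1 1) =
        DirectSum.of (𝒮.Component K) g q ∧ q.1 ≠ 0 ∧
        ∀ P : PrimeDivisor A, P.ord q.1 + 𝒮.rep g P = monomialDivisor D c.1 P :=
    fun c => isSection_coxHom_monomial D 𝒮 c.1 c.2
  choose q hq hq0 hqd using hsec
  have hχ : ∀ c, ∃ (d : K) (m : Fin r → ℤ), d ≠ 0 ∧ (q c).1 * h = d • X.χ m := fun c =>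
    X.exists_eq_smul_of_ord_eq_zero hunits (mul_ne_zero (hq0 c) hh0) fun P hP => by
      rw [P.ord_mul (hq0 c) hh0, hh P hP, hqd,
        monomialDivisor_apply_of_not_invariant D c.1 hP]
  choose d m hd hm using hχ
  have hminj : Function.Injective m := by
    intro c c' hcc
    have h1 : (q c).1 = (d c / d c') • (q c').1 := by
      rw [← mul_left_inj' hh0, smul_mul_assoc, hm, hm, hcc, smul_smul, div_mul_cancel₀ _ (hd c')]
    have h2 : ∀ P : PrimeDivisor A, P.ord (q c).1 = P.ord (q c').1 := fun P => by
      have h3 := div_ne_zero (hd c) (hd c')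
      rw [h1, Algebra.smul_def, IsScalarTower.algebraMap_apply K A, P.ord_mul _ (hq0 c'),
        P.ord_algebraMap h3, zero_add]
      rw [← IsScalarTower.algebraMap_apply]
      simpa using h3
    refine Subtype.ext (Finsupp.ext fun ρ => ?_)
    have h4 := hqd c (D ρ).1
    have h5 := hqd c' (D ρ).1
    rw [monomialDivisor_apply] at h4 h5
    rw [h2, h5] at h4
    exact_mod_cast h4.symm
  have hlin := X.linearIndependent.comp m hminj
  -- The projection to degree `g` kills monomials of other classes, leaving a single relation in the
  -- function field.
  let π : 𝒮.TotalCoordinateRing K →ₗ[K] FractionRing A :=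
    (Submodule.subtype _).comp (DirectSum.component K 𝒮.Degree (𝒮.Component K) g)
  have hπ : ∀ c : R →₀ ℕ, π (coxHom D 𝒮 (MvPolynomial.monomial c (p.coeff c))) =
      if hc : divisorClass (monomialDivisor D c) = 𝒮.equiv g then p.coeff c • (q ⟨c, hc⟩).1
      else 0 := by
    intro c
    have h0 : MvPolynomial.monomial c (p.coeff c) = p.coeff c • MvPolynomial.monomial c (1 : K) := by
      rw [MvPolynomial.smul_monomial, smul_eq_mul, mul_one]
    rw [h0, map_smul, map_smul]
    split_ifs with hc
    · rw [hq ⟨c, hc⟩]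
      congr 1
      exact congrArg Subtype.val (DirectSum.of_eq_same g (q ⟨c, hc⟩))
    · obtain ⟨f, hf, -⟩ := isSection_coxHom_monomial (K := K) D 𝒮 c
        (g := 𝒮.equiv.symm (divisorClass (monomialDivisor D c))) (by simp)
      have hne : 𝒮.equiv.symm (divisorClass (monomialDivisor D c)) ≠ g := fun h => hc (by
        rw [← h, AddEquiv.apply_symm_apply])
      rw [hf]
      have : π (DirectSum.of (𝒮.Component K) _ f) = 0 := by
        change ((DirectSum.of (𝒮.Component K) _ f) g).1 = 0
        rw [DirectSum.of_eq_of_ne _ _ _ hne.symm]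
        rfl
      rw [this, smul_zero]
  have hsum : ∑ c ∈ p.support.subtype
      (fun c => divisorClass (monomialDivisor D c) = 𝒮.equiv g),
      (p.coeff c.1 * d c) • X.χ (m c) = 0 := by
    have h1 := congrArg π hp
    rw [p.as_sum, map_sum, map_sum, map_zero] at h1
    simp only [hπ] at h1
    rw [← zero_mul h, ← h1, Finset.sum_mul]
    have h2 : ∀ c : {c : R →₀ ℕ // divisorClass (monomialDivisor D c) = 𝒮.equiv g},
        (p.coeff c.1 * d c) • X.χ (m c) = (fun c : R →₀ ℕ =>
          (if hc : divisorClass (monomialDivisor D c) = 𝒮.equiv g then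
            p.coeff c • (q ⟨c, hc⟩).1 else 0) * h) c.1 := by
      intro c
      simp only [dif_pos c.2]
      rw [smul_mul_assoc, hm, smul_smul]
    rw [Finset.sum_congr rfl fun c _ => h2 c]
    refine (Finset.sum_subtype_eq_sum_filter (f := fun c : R →₀ ℕ =>
      (if hc : divisorClass (monomialDivisor D c) = 𝒮.equiv g then
        p.coeff c • (q ⟨c, hc⟩).1 else 0) * h)).trans ?_
    rw [Finset.sum_filter]
    refine Finset.sum_congr rfl fun c _ => ?_
    split_ifs with hc
    · rfl
    · rw [zero_mul]
  by_contra hc0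
  have := linearIndependent_iff'.mp hlin _ _ hsum ⟨c₀, by simp [g]⟩ (by simpa using hc0)
  exact (mul_ne_zero hc0 (hd _)) this

/-- The total coordinate ring is the Cox ring. -/
theorem exists_coxEquiv : ∃ φ : 𝒮.TotalCoordinateRing K ≃ₐ[K] MvPolynomial R K,
    ∀ g : 𝒮.Degree, (LinearMap.range (DirectSum.lof K 𝒮.Degree (𝒮.Component K) g)).map
      φ.toLinearMap = MvPolynomial.weightedHomogeneousSubmodule K
        (fun ρ => divisorClass (Finsupp.single (D ρ).1 1)) (𝒮.equiv g) := by
  have hrange : ∀ g : 𝒮.Degree, LinearMap.range (DirectSum.lof K 𝒮.Degree (𝒮.Component K) g) =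
      (MvPolynomial.weightedHomogeneousSubmodule K
        (fun ρ => divisorClass (Finsupp.single (D ρ).1 1)) (𝒮.equiv g)).map
          (coxHom (K := K) D 𝒮).toLinearMap := by
    intro g
    refine le_antisymm (X.range_lof_le D 𝒮 hunits g) ?_
    rintro _ ⟨p, hp, rfl⟩
    rw [SetLike.mem_coe, mem_weightedHomogeneousSubmodule_iff] at hp
    rw [p.as_sum, map_sum]
    refine sum_mem fun c hc => ?_
    rw [show MvPolynomial.monomial c (p.coeff c) = p.coeff c • MvPolynomial.monomial c (1 : K) by
      rw [MvPolynomial.smul_monomial, smul_eq_mul, mul_one], map_smul]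
    obtain ⟨f, hf, -⟩ := isSection_coxHom_monomial (K := K) D 𝒮 c
      (hp c (MvPolynomial.mem_support_iff.mp hc))
    exact Submodule.smul_mem _ _ ⟨f, hf.symm⟩
  have hsurj : Function.Surjective (coxHom (K := K) D 𝒮) := by
    intro x
    change x ∈ LinearMap.range (coxHom (K := K) D 𝒮).toLinearMap
    induction x using DirectSum.induction_on with
    | zero => exact zero_mem _
    | of g a =>
      obtain ⟨p, -, hp⟩ := X.range_lof_le D 𝒮 hunits g ⟨a, rfl⟩
      exact ⟨p, hp⟩
    | add x y hx hy => exact add_mem hx hy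
  let ψ := AlgEquiv.ofBijective (coxHom (K := K) D 𝒮) ⟨X.coxHom_injective D 𝒮 hunits, hsurj⟩
  refine ⟨ψ.symm, fun g => ?_⟩
  rw [hrange]
  ext p
  constructor
  · rintro ⟨_, ⟨p, hp, rfl⟩, rfl⟩
    exact (ψ.symm_apply_apply p).symm ▸ hp
  · intro hp
    exact ⟨_, ⟨p, hp, rfl⟩, ψ.symm_apply_apply p⟩

end TorusAction.CharacterSystem

end

theorem lemma6 {K : Type*} [Field K] [IsAlgClosed K] [CharZero K]
    {A : Type*} [CommRing A] [IsDomain A] [Algebra K A] [Algebra.FiniteType K A]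
    [IsNoetherianRing A] [IsIntegrallyClosed A]
    {r : ℕ} (T : TorusAction K r A) (hT : T.LocallyTransitive) (hTeff : T.Effective)
    (hunits : ∀ u : A, IsUnit u → ∃ c : K, algebraMap K A c = u) :
    ∃ D : T.Ray ≃ {P : PrimeDivisor A // T.Invariant P},
      (∀ ρ, (D ρ).1.asIdeal = T.rayIdeal ρ) ∧
      Finite T.Ray ∧
      Nonempty (ClassGroupSplitting A) ∧
      ∀ 𝒮 : ClassGroupSplitting A,
        ∃ φ : 𝒮.TotalCoordinateRing K ≃ₐ[K] MvPolynomial T.Ray K,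
          ∀ g : 𝒮.Degree,
            (LinearMap.range (DirectSum.lof K 𝒮.Degree (𝒮.Component K) g)).map
                φ.toLinearMap =
              MvPolynomial.weightedHomogeneousSubmodule K
                (fun ρ => divisorClass (Finsupp.single (D ρ).1 1)) (𝒮.equiv g) := by
  obtain ⟨X⟩ := T.nonempty_characterSystem hT hTeff
  have := X.finite_invariant
  let _ := Fintype.ofFinite {P : PrimeDivisor A // T.Invariant P}
  let _ : Fintype T.Ray := Fintype.ofEquiv _ X.rayEquiv.symm
  have := X.fg_divisorClassGroup
  exact ⟨X.rayEquiv, X.asIdeal_rayEquiv, inferInstance, ClassGroupSplitting.nonempty_of_fg,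
    fun 𝒮 => X.exists_coxEquiv X.rayEquiv 𝒮 hunits⟩
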